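/- Let $C=\{\mathsf T,\mathsf F,\mathsf U\}$ be the three-element algebra with negation $\neg\mathsf T=\mathsf F$, $\neg\mathsf F=\mathsf T$, $\neg\mathsf U=\mathsf U$, conjunction $\mathsf T\wedge y=y$, $\mathsf F\wedge y=\mathsf F$, $\mathsf U\wedge y=\mathsf U$, and disjunction $\mathsf T\vee y=\mathsf T$, $\mathsf F\vee y=y$, $\mathsf U\vee y=\mathsf U$ (McCarthy's sequential, i.e. short-circuit, connectives). For $S\subseteq\{\mathsf T,\mathsf F,\mathsf U\}$, conditional logic with the elements of $S$ distinguished is the equational logic over the signature with $\neg,\wedge,\vee$ and a constant symbol for each element of $S$ that has Guzmán and Squier's axioms \[ \begin{aligned} &\neg\neg x=x,\qquad \neg(x\wedge y)=\neg x\vee\neg y,\qquad (x\wedge y)\wedge z=x\wedge(y\wedge z),\qquad x\wedge(y\vee z)=(x\wedge y)\vee(x\wedge z),\\ &(x\vee y)\wedge z=(x\wedge z)\vee(\neg x\wedge y\wedge z),\qquad x\vee(x\wedge y)=x,\qquad (x\wedge y)\vee(y\wedge x)=(y\wedge x)\vee(x\wedge y), \end{aligned} \] together with $\neg\mathsf U=\mathsf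 U$ if $\mathsf U\in S$, and with $\mathsf T\wedge x=x$ and $\neg\mathsf T=\mathsf F$ if $\mathsf T,\mathsf F\in S$. A set $E$ of equations over this signature completely axiomatises conditional logic with $S$ distinguished if, for all open terms $s,t$ over any set of variables, the following are equivalent: $s=t$ is derivable from $E$ in equational logic; $s=t$ is derivable from the axioms just listed; $s=t$ is valid in $C$ (for all valuations of the variables, the constants denoting themselves). The set $E$ is independent if no $e\in E$ is derivable from $E\setminus\{e\}$. Consider the equations \[ \begin{aligned} &\text{(Neg)}\ \ \mathsf F=\neg\mathsf T, &&\text{(Or)}\ \ x\vee y=\neg(\neg x\wedge\neg y), &&\text{(Tand)}\ \ \mathsf T\wedge x=x,\\ &\text{(Abs)}\ \ x\wedge(x\vee y)=x, &&\text{(Mem)}\ \ (x\vee y)\wedge z=(\neg x\wedge(y\wedge z))\vee(x\wedge z),\\ &\text{(Com)}\ \ (x\wedge y)\vee(y\wedge x)=(y\wedge x)\vee(x\wedge y), &&\text{(Und)}\ \ \neg\mathsf U=\mathsf U. \end{aligned} \] (i) Conditional logic with no constants distinguished is completely axiomatised by the five axioms $\neg\neg x=x$, (Or), (Abs), (Mem),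 (Com), and these axioms are independent. (ii) Conditional logic with $\mathsf T$ and $\mathsf F$ distinguished is completely axiomatised by the six axioms (Neg), (Or), (Tand), (Abs), (Mem), (Com), and these axioms are independent. (iii) Conditional logic with only $\mathsf U$ distinguished is completely axiomatised by the six axioms $\neg\neg x=x$, (Und), (Or), (Abs), (Mem), (Com), and these axioms are independent. (iv) Conditional logic with $\mathsf T$, $\mathsf F$ and $\mathsf U$ distinguished is completely axiomatised by the seven axioms (Neg), (Or), (Tand), (Abs), (Mem), (Com), (Und), and these axioms are independent. -/

import Mathlib

universe u

namespace CondLogic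

/-- The three truth values: the carrier of the three-element algebra `C`. -/
inductive TV : Type
  | T
  | F
  | U
  deriving DecidableEq

namespace TV

/-- Negation on `C`. -/
def neg : TV → TV
  | T => F
  | F => T
  | U => U

/-- Short-circuit conjunction on `C`. -/
def and : TV → TV → TV
  | T, y => y
  | F, _ => F
  | U, _ => U

/-- Short-circuit disjunction on `C`. -/
def or : TV → TV → TV
  | T, _ => T
  | F, y => y
  | U, _ => U

end TV

/-- Open terms over the connectives `¬`, `∧`, `∨` and a constant symbol for each element of the
set `S` of distinguished truth values, with variables in `X`. -/
inductive Term (S : Set TV) (X : Type u) : Type u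
  | var (x : X) : Term S X
  | const (c : S) : Term S X
  | neg (t : Term S X) : Term S X
  | and (s t : Term S X) : Term S X
  | or (s t : Term S X) : Term S X

namespace Term

/-- Simultaneous substitution of terms for variables. -/
def subst {S : Set TV} {X : Type} {Y : Type u} (σ : X → Term S Y) : Term S X → Term S Y
  | var x => σ x
  | const c => const c
  | neg t => neg (subst σ t)
  | and s t => and (subst σ s) (subst σ t)
  | or s t => or (subst σ s) (subst σ t)

/-- The value of a term in `C` under a valuation of its variables; the constant symbol of a
distinguished truth value denotes that truth value. -/
def eval {S : Set TV} {X : Type u} (v : X → TV) : Term S X → TV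
  | var x => v x
  | const c => c
  | neg t => (eval v t).neg
  | and s t => (eval v s).and (eval v t)
  | or s t => (eval v s).or (eval v t)

end Term

/-- Equations between open terms, over a fixed countably infinite set of variables. -/
structure Equation (S : Set TV) : Type where
  lhs : Term S ℕ
  rhs : Term S ℕ

/-- `Derivable E s t`: the equation `s = t` is derivable from the equations in `E` in equational
logic (substitution instances of the equations in `E`, reflexivity, symmetry, transitivity,
congruence). -/
inductive Derivable {S : Set TV} (E : Set (Equation S)) {X : Type u} :
    Term S X → Term S X → Prop
  | ax (e : Equation S) (he : e ∈ E) (σ : ℕ → Term S X) :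
      Derivable E (e.lhs.subst σ) (e.rhs.subst σ)
  | refl (t : Term S X) : Derivable E t t
  | symm {s t : Term S X} : Derivable E s t → Derivable E t s
  | trans {r s t : Term S X} : Derivable E r s → Derivable E s t → Derivable E r t
  | neg {s t : Term S X} : Derivable E s t → Derivable E s.neg t.neg
  | and {s s' t t' : Term S X} :
      Derivable E s s' → Derivable E t t' → Derivable E (s.and t) (s'.and t')
  | or {s s' t t' : Term S X} :
      Derivable E s s' → Derivable E t t' → Derivable E (s.or t) (s'.or t')

/-- The equation `s = t` is valid in `C`. -/
def Valid {S : Set TV} {X : Type u} (s t : Term S X) : Prop :=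
  ∀ v : X → TV, s.eval v = t.eval v

section Axioms

variable {S : Set TV}

/-- The variable `x` of the axioms. -/
def x : Term S ℕ := .var 0

/-- The variable `y` of the axioms. -/
def y : Term S ℕ := .var 1

/-- The variable `z` of the axioms. -/
def z : Term S ℕ := .var 2

/-- `¬¬x = x` -/
def dnegAx : Equation S := ⟨x.neg.neg, x⟩

/-- `¬(x ∧ y) = ¬x ∨ ¬y` -/
def deMorganAx : Equation S := ⟨(x.and y).neg, x.neg.or y.neg⟩

/-- `(x ∧ y) ∧ z = x ∧ (y ∧ z)` -/
def assocAx : Equation S := ⟨(x.and y).and z, x.and (y.and z)⟩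

/-- `x ∧ (y ∨ z) = (x ∧ y) ∨ (x ∧ z)` -/
def distribAx : Equation S := ⟨x.and (y.or z), (x.and y).or (x.and z)⟩

/-- `(x ∨ y) ∧ z = (x ∧ z) ∨ (¬x ∧ y ∧ z)`; the bracketing of the last conjunction is immaterial
in the presence of `assocAx`. -/
def condAx : Equation S := ⟨(x.or y).and z, (x.and z).or (x.neg.and (y.and z))⟩

/-- `x ∨ (x ∧ y) = x` -/
def dualAbsAx : Equation S := ⟨x.or (x.and y), x⟩

/-- Com: `(x ∧ y) ∨ (y ∧ x) = (y ∧ x) ∨ (x ∧ y)` -/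
def comAx : Equation S := ⟨(x.and y).or (y.and x), (y.and x).or (x.and y)⟩

/-- Or: `x ∨ y = ¬(¬x ∧ ¬y)` -/
def orAx : Equation S := ⟨x.or y, (x.neg.and y.neg).neg⟩

/-- Abs: `x ∧ (x ∨ y) = x` -/
def absAx : Equation S := ⟨x.and (x.or y), x⟩

/-- Mem: `(x ∨ y) ∧ z = (¬x ∧ (y ∧ z)) ∨ (x ∧ z)` -/
def memAx : Equation S := ⟨(x.or y).and z, (x.neg.and (y.and z)).or (x.and z)⟩

/-- Und: `¬U = U` -/
def undAx (hU : TV.U ∈ S) : Equation S := ⟨(Term.const ⟨TV.U, hU⟩).neg, .const ⟨TV.U, hU⟩⟩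

/-- Tand: `T ∧ x = x` -/
def tandAx (hT : TV.T ∈ S) : Equation S := ⟨(Term.const ⟨TV.T, hT⟩).and x, x⟩

/-- `¬T = F` -/
def negTAx (hT : TV.T ∈ S) (hF : TV.F ∈ S) : Equation S :=
  ⟨(Term.const ⟨TV.T, hT⟩).neg, .const ⟨TV.F, hF⟩⟩

/-- Neg: `F = ¬T` -/
def negAx (hT : TV.T ∈ S) (hF : TV.F ∈ S) : Equation S :=
  ⟨.const ⟨TV.F, hF⟩, (Term.const ⟨TV.T, hT⟩).neg⟩

/-- The axioms of Guzmán and Squier for conditional logic with the elements of `S` distinguished: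
seven axioms without constants, `¬U = U` if `U` is distinguished, `T ∧ x = x` and `¬T = F` if `T`
and `F` are distinguished. -/
def gsAxioms (S : Set TV) : Set (Equation S) :=
  {dnegAx, deMorganAx, assocAx, distribAx, condAx, dualAbsAx, comAx}
    ∪ {e | ∃ hU : TV.U ∈ S, e = undAx hU}
    ∪ {e | ∃ (hT : TV.T ∈ S) (hF : TV.F ∈ S), e = tandAx hT ∨ e = negTAx hT hF}

end Axioms

/-- The axioms for conditional logic with no constants distinguished. -/
def eqCLNone : Set (Equation ∅) :=
  {dnegAx, orAx, absAx, memAx, comAx}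

/-- The axioms EqCL for conditional logic with `T` and `F` distinguished. -/
def eqCL : Set (Equation {TV.T, TV.F}) :=
  {negAx (by simp) (by simp), orAx, tandAx (by simp), absAx, memAx, comAx}

/-- The axioms for conditional logic with only `U` distinguished. -/
def eqCLOnlyU : Set (Equation {TV.U}) :=
  {dnegAx, undAx (by simp), orAx, absAx, memAx, comAx}

/-- The axioms EqCL^U for conditional logic with `T`, `F` and `U` distinguished. -/
def eqCLU : Set (Equation {TV.T, TV.F, TV.U}) :=
  {negAx (by simp) (by simp), orAx, tandAx (by simp), absAx, memAx, comAx, undAx (by simp)}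

/-- `E` completely axiomatises conditional logic with the elements of `S` distinguished: the
equations derivable from `E` are exactly those valid in the algebra `C`, and exactly those
derivable from the axioms of Guzmán and Squier. -/
def CompletelyAxiomatisesCL {S : Set TV} (E : Set (Equation S)) : Prop :=
  ∀ (X : Type u) (s t : Term S X),
    (Derivable E s t ↔ Valid s t) ∧ (Derivable E s t ↔ Derivable (gsAxioms S) s t)

/-- No equation in `E` is derivable from the others. -/
def Independent {S : Set TV} (E : Set (Equation S)) : Prop :=
  ∀ e ∈ E, ¬ Derivable (E \ {e}) e.lhs e.rhs

end CondLogic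

/-!
By Or, exchanging `∧` and `∨` preserves the axioms `¬¬x = x`, Or, Abs, Mem and Com, which halves
the equational work of deriving from them the axioms of Guzmán and Squier. In a model of the
latter with constants for `T` and `F`, every term equals a decision tree that inspects one
variable at a time. If two decision trees have the same truth values, then each of them is
undefined whenever the root variable `x` of either one is, and hence is determined by its
restrictions to `x = T` and to `x = F`; these have fewer nodes, so by induction the two trees
agree in every such model.

Without constants for `T` and `F`, put `e = x ∨ ¬x` for an element `x` of a model. This test is
never `F`, so the elements below `e` form a model in which `e` plays the role of `T`, and valid
equations hold after both sides are conjoined with `e`. A term whose evaluation begins by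
inspecting `x` is unchanged by that, and any two such tests commute, so valid equations hold in
all models and in particular in the free one.

Each axiom is independent of the others by a model with at most four elements.
-/

namespace CondLogic

/-! ### Memorising and conditional algebras -/

section Operations

variable {A : Type*} (neg : A → A) (and or : A → A → A)

local prefix:max "∼" => neg
local infixr:70 " ⋏ " => and
local infixr:65 " ⋎ " => or

/-- Algebras satisfying the constant-free axioms `¬¬x = x`, Or, Abs, Mem and Com. The operations are
not bundled, so that the dual of an algebra is obtained by exchanging `and` and `or`. -/
structure IsMemorising : Prop where
  neg_neg x : ∼∼x = x
  or_eq x y : x ⋎ y = ∼(∼x ⋏ ∼y)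
  absorb x y : x ⋏ (x ⋎ y) = x
  mem x y z : (x ⋎ y) ⋏ z = ∼x ⋏ y ⋏ z ⋎ x ⋏ z
  com x y : x ⋏ y ⋎ y ⋏ x = y ⋏ x ⋎ x ⋏ y

/-- Guzmán and Squier's C-algebras: algebras satisfying their constant-free axioms. -/
structure IsConditional : Prop where
  neg_neg x : ∼∼x = x
  neg_and x y : ∼(x ⋏ y) = ∼x ⋎ ∼y
  and_assoc x y z : (x ⋏ y) ⋏ z = x ⋏ y ⋏ z
  and_or_distrib x y z : x ⋏ (y ⋎ z) = x ⋏ y ⋎ x ⋏ z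
  or_and x y z : (x ⋎ y) ⋏ z = x ⋏ z ⋎ ∼x ⋏ y ⋏ z
  absorb x y : x ⋎ x ⋏ y = x
  com x y : x ⋏ y ⋎ y ⋏ x = y ⋏ x ⋎ x ⋏ y

variable {neg and or}

namespace IsMemorising

theorem neg_and (h : IsMemorising neg and or) (x y : A) : ∼(x ⋏ y) = ∼x ⋎ ∼y := by
  rw [h.or_eq, h.neg_neg, h.neg_neg]

theorem neg_or (h : IsMemorising neg and or) (x y : A) : ∼(x ⋎ y) = ∼x ⋏ ∼y := by
  rw [h.or_eq, h.neg_neg]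

theorem dual (h : IsMemorising neg and or) : IsMemorising neg or and where
  neg_neg := h.neg_neg
  or_eq x y := by rw [h.neg_or, h.neg_neg, h.neg_neg]
  absorb x y := by
    simpa only [h.neg_and, h.neg_or, h.neg_neg] using congrArg neg (h.absorb ∼x ∼y)
  mem x y z := by
    simpa only [h.neg_and, h.neg_or, h.neg_neg] using congrArg neg (h.mem ∼x ∼y ∼z)
  com x y := by
    simpa only [h.neg_and, h.neg_or, h.neg_neg] using congrArg neg (h.com ∼x ∼y)

theorem mem_neg (h : IsMemorising neg and or) (x y z : A) :
    (∼x ⋎ y) ⋏ z = x ⋏ y ⋏ z ⋎ ∼x ⋏ z := by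
  rw [h.mem, h.neg_neg]

theorem and_self (h : IsMemorising neg and or) (x : A) : x ⋏ x = x := by
  calc x ⋏ x = x ⋏ (x ⋎ x ⋏ x) := by rw [h.dual.absorb]
    _ = x := h.absorb x (x ⋏ x)

theorem or_neg_and_or_self (h : IsMemorising neg and or) (x y : A) :
    x ⋎ ∼x ⋏ (x ⋎ y) = x ⋎ y := by
  calc x ⋎ ∼x ⋏ (x ⋎ y) = x ⋏ (x ⋎ y) ⋎ ∼x ⋏ (x ⋎ y) := by rw [h.absorb]
    _ = (∼x ⋎ x ⋎ y) ⋏ (x ⋎ y) := by rw [h.mem_neg, h.and_self]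
    _ = x ⋏ x ⋎ y := (h.dual.mem x x y).symm
    _ = x ⋎ y := by rw [h.and_self]

theorem neg_and_self (h : IsMemorising neg and or) (x : A) : ∼x ⋏ x = x ⋏ ∼x := by
  have neg_or_and_neg : ∼x ⋎ x ⋏ ∼x = ∼x := by
    simpa only [h.neg_neg, h.dual.and_self] using h.or_neg_and_or_self ∼x ∼x
  calc ∼x ⋏ x = (∼x ⋎ ∼x ⋎ x ⋏ ∼x) ⋏ (x ⋎ x ⋏ ∼x) := by
        rw [neg_or_and_neg, h.dual.and_self, h.dual.absorb]
    _ = x ⋏ ∼x ⋎ x ⋏ ∼x := (h.dual.mem x ∼x (x ⋏ ∼x)).symm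
    _ = x ⋏ ∼x := h.dual.and_self _

theorem neg_or_neg (h : IsMemorising neg and or) (x : A) : ∼(x ⋎ ∼x) = x ⋏ ∼x := by
  rw [h.neg_or, h.neg_neg, h.neg_and_self]

theorem or_neg_and_or (h : IsMemorising neg and or) (x y : A) : (x ⋎ ∼x) ⋏ (x ⋎ y) = x ⋎ y := by
  calc (x ⋎ ∼x) ⋏ (x ⋎ y) = (∼x ⋎ x) ⋏ (x ⋎ y) := by rw [h.dual.neg_and_self]
    _ = x ⋏ x ⋏ (x ⋎ y) ⋎ ∼x ⋏ (x ⋎ y) := h.mem_neg x x (x ⋎ y)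
    _ = x ⋎ ∼x ⋏ (x ⋎ y) := by rw [h.absorb, h.and_self]
    _ = x ⋎ y := h.or_neg_and_or_self x y

theorem or_neg_or_self (h : IsMemorising neg and or) (x : A) : (x ⋎ ∼x) ⋎ x = x ⋎ ∼x := by
  have or_neg_and : (x ⋎ ∼x) ⋏ x = x := by
    simpa only [h.dual.and_self] using h.or_neg_and_or x x
  calc (x ⋎ ∼x) ⋎ x = (x ⋎ ∼x) ⋎ (x ⋎ ∼x) ⋏ x := by rw [or_neg_and]
    _ = x ⋎ ∼x := h.dual.absorb _ _

theorem and_neg_or_or (h : IsMemorising neg and or) (x y : A) : x ⋏ ∼x ⋎ x ⋎ y = x ⋎ y := by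
  calc x ⋏ ∼x ⋎ x ⋎ y
      = ∼(x ⋎ ∼x) ⋏ x ⋏ (x ⋎ y) ⋎ (x ⋎ ∼x) ⋏ (x ⋎ y) := by
        rw [h.neg_or_neg, h.absorb, h.dual.or_neg_or_self, h.or_neg_and_or]
    _ = ((x ⋎ ∼x) ⋎ x) ⋏ (x ⋎ y) := (h.mem _ _ _).symm
    _ = x ⋎ y := by rw [h.or_neg_or_self, h.or_neg_and_or]

theorem or_and_or_neg (h : IsMemorising neg and or) (x y : A) : (x ⋎ y) ⋏ (x ⋎ ∼x) = x ⋎ y := by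
  have or_neg_or : (x ⋎ ∼x) ⋎ x ⋎ y = x ⋎ ∼x := by
    simpa only [h.or_neg_and_or] using h.dual.absorb (x ⋎ ∼x) (x ⋎ y)
  calc (x ⋎ y) ⋏ (x ⋎ ∼x)
      = (∼(x ⋎ ∼x) ⋎ (x ⋎ y) ⋎ x ⋎ y) ⋏ ((x ⋎ ∼x) ⋎ x ⋎ y) := by
        rw [h.neg_or_neg, h.dual.and_self (x ⋎ y), h.and_neg_or_or, or_neg_or]
    _ = (x ⋎ ∼x) ⋏ (x ⋎ y) ⋎ x ⋎ y := (h.dual.mem _ _ _).symm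
    _ = x ⋎ y := by rw [h.or_neg_and_or, h.dual.and_self]

theorem or_neg_or (h : IsMemorising neg and or) (x y : A) : x ⋎ ∼x ⋎ y = x ⋎ ∼x := by
  have neg_or_and : (∼x ⋎ y) ⋏ (x ⋎ ∼x) = ∼x ⋎ y := by
    simpa only [h.neg_neg, h.dual.neg_and_self] using h.or_and_or_neg ∼x y
  calc x ⋎ ∼x ⋎ y = (x ⋎ ∼x ⋎ y) ⋏ (x ⋎ ∼x) := (h.or_and_or_neg _ _).symm
    _ = ∼x ⋏ (∼x ⋎ y) ⋏ (x ⋎ ∼x) ⋎ x ⋏ (x ⋎ ∼x) := h.mem _ _ _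
    _ = ∼x ⋎ x := by rw [neg_or_and, h.absorb, h.absorb]
    _ = x ⋎ ∼x := h.dual.neg_and_self x

theorem neg_and_and_or_or (h : IsMemorising neg and or) (x y z : A) :
    ∼x ⋏ (x ⋏ y ⋎ z) ⋎ x = x ⋎ z := by
  calc ∼x ⋏ (x ⋏ y ⋎ z) ⋎ x = ∼x ⋏ (∼x ⋎ y ⋎ z) ⋏ (x ⋎ z) ⋎ x ⋏ (x ⋎ z) := by
        rw [h.dual.mem x y z, h.absorb x z]
    _ = (x ⋎ ∼x ⋎ y ⋎ z) ⋏ (x ⋎ z) := (h.mem _ _ _).symm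
    _ = x ⋎ z := by rw [h.or_neg_or, h.or_neg_and_or]

theorem neg_or_and_self (h : IsMemorising neg and or) (x y : A) : (∼x ⋎ y) ⋏ x = x ⋏ y ⋏ x := by
  calc (∼x ⋎ y) ⋏ x = x ⋏ y ⋏ x ⋎ ∼x ⋏ x := h.mem_neg x y x
    _ = x ⋏ y ⋏ x := by rw [h.neg_and_self, h.dual.or_and_or_neg]

theorem and_or_and_and_self (h : IsMemorising neg and or) (x y z : A) :
    x ⋏ ((x ⋎ y) ⋏ z) ⋏ x = x ⋏ z := by
  rw [← h.neg_or_and_self, h.dual.neg_and_and_or_or]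

theorem and_and_and_self (h : IsMemorising neg and or) (x y : A) : x ⋏ (x ⋏ y) ⋏ x = x ⋏ y := by
  simpa only [h.dual.and_self] using h.and_or_and_and_self x x y

theorem and_and_self_left (h : IsMemorising neg and or) (x y : A) : x ⋏ x ⋏ y = x ⋏ y := by
  calc x ⋏ x ⋏ y = x ⋏ (x ⋏ y) ⋎ x ⋏ ∼x := (h.dual.or_and_or_neg _ _).symm
    _ = (∼x ⋎ x ⋏ y ⋎ x ⋏ ∼x) ⋏ (x ⋎ x ⋏ ∼x) := h.dual.mem _ _ _
    _ = (∼x ⋎ x ⋏ y) ⋏ x := by rw [h.dual.or_and_or_neg, h.dual.absorb]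
    _ = x ⋏ y := by rw [h.neg_or_and_self, h.and_and_and_self]

theorem or_and_self_right (h : IsMemorising neg and or) (x y : A) :
    (x ⋎ y) ⋏ y = (x ⋎ ∼x) ⋏ y := by
  rw [h.mem, h.mem, h.and_self, h.and_and_self_left]

theorem and_neg_or_eq_and_and_self (h : IsMemorising neg and or) (x y : A) :
    x ⋏ (∼x ⋎ y) = x ⋏ y ⋏ x := by
  have neg_or_and_neg_or : ∼x ⋎ x ⋏ (∼x ⋎ y) = ∼x ⋎ y := by
    simpa only [h.neg_neg] using h.or_neg_and_or_self ∼x y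
  calc x ⋏ (∼x ⋎ y) = x ⋏ (x ⋏ (∼x ⋎ y)) ⋏ x := (h.and_and_and_self _ _).symm
    _ = (∼x ⋎ x ⋏ (∼x ⋎ y)) ⋏ x := (h.neg_or_and_self _ _).symm
    _ = x ⋏ y ⋏ x := by rw [neg_or_and_neg_or, h.neg_or_and_self]

theorem and_neg_or_or_neg (h : IsMemorising neg and or) (x y : A) :
    x ⋏ (∼x ⋎ y ⋎ ∼x) = x ⋏ y := by
  calc x ⋏ (∼x ⋎ y ⋎ ∼x) = x ⋏ (∼x ⋎ x ⋏ y) := by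
        rw [← h.dual.and_neg_or_eq_and_and_self, h.neg_neg]
    _ = x ⋏ y := h.dual.or_neg_and_or_self x y

theorem and_neg_or_or_and (h : IsMemorising neg and or) (x y z : A) :
    x ⋏ (∼x ⋎ (x ⋎ y) ⋏ z) = x ⋏ z := by
  rw [h.and_neg_or_eq_and_and_self, h.and_or_and_and_self]

theorem and_or_and (h : IsMemorising neg and or) (x y z : A) : x ⋏ (x ⋎ y) ⋏ z = x ⋏ z := by
  calc x ⋏ (x ⋎ y) ⋏ z = x ⋏ ((x ⋎ y) ⋏ (x ⋎ y) ⋏ z) ⋏ x := (h.and_or_and_and_self _ _ _).symm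
    _ = x ⋏ z := by rw [h.and_and_self_left, h.and_or_and_and_self]

theorem or_or_and_neg (h : IsMemorising neg and or) (x y : A) : (x ⋎ y) ⋎ x ⋏ ∼x = x ⋎ y := by
  have neg_and_neg : ∼(x ⋏ ∼x) = x ⋎ ∼x := h.dual.neg_or_neg x
  have := h.neg_and_and_or_or (x ⋏ ∼x) (x ⋏ ∼x) (x ⋎ y)
  rwa [neg_and_neg, h.and_self, h.and_neg_or_or, h.or_neg_and_or] at this

theorem or_or_self_right (h : IsMemorising neg and or) (x y : A) : (x ⋎ y) ⋎ y = x ⋎ y := by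
  have and_neg_or : x ⋏ ∼x ⋎ y = (x ⋎ y) ⋏ (∼x ⋎ y) := by
    rw [← h.neg_and_self, h.dual.mem, h.neg_neg, h.dual.and_and_self_left]
  have or_and_or : (x ⋎ y) ⋏ y ⋎ y = x ⋏ ∼x ⋎ y := by
    rw [h.or_and_self_right, h.dual.or_and_self_right, h.neg_or_neg, h.dual.and_neg_or_or]
  calc (x ⋎ y) ⋎ y = (x ⋎ y) ⋎ (x ⋎ y) ⋏ y ⋎ y := (h.dual.and_or_and _ _ _).symm
    _ = (x ⋎ y) ⋎ (x ⋎ y) ⋏ (∼x ⋎ y) := by rw [or_and_or, and_neg_or]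
    _ = x ⋎ y := h.dual.absorb _ _

theorem and_or_neg (h : IsMemorising neg and or) (x y : A) : x ⋏ (y ⋎ ∼x) = x ⋏ y := by
  rw [← h.and_neg_or_or_neg x (y ⋎ ∼x), h.or_or_self_right, h.and_neg_or_or_neg]

theorem and_or_neg_and (h : IsMemorising neg and or) (x y z : A) :
    x ⋏ (y ⋎ ∼x ⋏ z) = x ⋏ y := by
  have neg_and : ∼x ⋏ z = ∼(x ⋎ ∼z) := by rw [h.neg_or, h.neg_neg]
  calc x ⋏ (y ⋎ ∼x ⋏ z) = x ⋏ (∼x ⋎ (x ⋎ ∼z) ⋏ (y ⋎ ∼(x ⋎ ∼z))) := by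
        rw [neg_and, h.and_neg_or_or_and]
    _ = x ⋏ y := by rw [h.and_or_neg, h.and_neg_or_or_and]

theorem and_neg_or_and (h : IsMemorising neg and or) (x y z : A) :
    x ⋏ (∼x ⋎ y) ⋏ z = x ⋏ y ⋏ z := by
  rw [h.mem_neg, h.and_or_neg_and, h.and_and_self_left]

theorem and_and_self_and (h : IsMemorising neg and or) (x y z : A) :
    x ⋏ (y ⋏ x) ⋏ z = x ⋏ y ⋏ z := by
  have neg_or_and : ∼x ⋎ y ⋏ x = ∼x ⋎ y := by
    simpa only [h.neg_neg] using h.dual.and_or_neg ∼x y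
  rw [← h.and_neg_or_and, neg_or_and, h.and_neg_or_and]

theorem or_or_self (h : IsMemorising neg and or) (x y : A) : x ⋎ y ⋎ x = x ⋎ y := by
  calc x ⋎ y ⋎ x = x ⋎ (y ⋎ x) ⋎ y ⋏ ∼y := by rw [h.or_or_and_neg]
    _ = x ⋎ y := by rw [h.dual.and_and_self_and, h.dual.absorb]

theorem and_neg_or (h : IsMemorising neg and or) (x y : A) : x ⋏ (∼x ⋎ y) = x ⋏ y := by
  rw [h.and_neg_or_eq_and_and_self, h.dual.or_or_self]

theorem neg_or_and (h : IsMemorising neg and or) (x y : A) : (∼x ⋎ y) ⋏ x = x ⋏ y := by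
  rw [h.neg_or_and_self, h.dual.or_or_self]

theorem and_and_and_left (h : IsMemorising neg and or) (x y z : A) :
    (x ⋏ y) ⋏ x ⋏ z = (x ⋏ y) ⋏ z := by
  rw [← h.and_and_self_and, h.and_and_self_left x y, h.and_and_self_left]

theorem and_neg_and (h : IsMemorising neg and or) (x y : A) : (x ⋏ ∼x) ⋏ y = x ⋏ ∼x := by
  calc (x ⋏ ∼x) ⋏ y = (x ⋏ ∼x) ⋏ x ⋏ y := (h.and_and_and_left _ _ _).symm
    _ = (x ⋏ ∼x) ⋏ (x ⋏ ∼x ⋎ x ⋏ y) := by rw [h.dual.or_neg_and_or]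
    _ = x ⋏ ∼x := h.absorb _ _

theorem and_and_left_and (h : IsMemorising neg and or) (x y z : A) :
    x ⋏ (x ⋏ y) ⋏ z = x ⋏ y ⋏ z := by
  have neg_or_and : ∼x ⋎ x ⋏ y = ∼x ⋎ y := by
    simpa only [h.neg_neg] using h.dual.and_neg_or ∼x y
  rw [← h.and_neg_or_and, neg_or_and, h.and_neg_or_and]

theorem and_and_and_self_left (h : IsMemorising neg and or) (x y z : A) :
    x ⋏ y ⋏ x ⋏ z = x ⋏ y ⋏ z := by
  calc x ⋏ y ⋏ x ⋏ z = x ⋏ y ⋏ (y ⋏ x) ⋏ z := by rw [h.and_and_left_and]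
    _ = x ⋏ (y ⋏ x) ⋏ (y ⋏ x) ⋏ z := (h.and_and_self_and _ _ _).symm
    _ = x ⋏ y ⋏ z := by rw [h.and_and_self_left, h.and_and_self_and]

theorem neg_or_and_and (h : IsMemorising neg and or) (x y z : A) :
    (∼x ⋎ y) ⋏ x ⋏ z = x ⋏ y ⋏ z := by
  have neg_and_and : ∼x ⋏ x ⋏ z = x ⋏ ∼x := by
    simpa only [h.neg_neg, h.neg_and_self] using h.dual.or_neg_or ∼x z
  rw [h.mem_neg, h.and_and_and_self_left, neg_and_and, h.dual.or_and_or_neg]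

-- By Mem, `(a ∨ b) ∧ w` depends on `b` only through `b ∧ w`, and both `x ∧ ¬x` and `¬x` meet
-- `x ∧ z` in `x ∧ ¬x`.
theorem and_assoc (h : IsMemorising neg and or) (x y z : A) : (x ⋏ y) ⋏ z = x ⋏ y ⋏ z := by
  have neg_and_and : ∼x ⋏ x ⋏ z = (x ⋏ ∼x) ⋏ x ⋏ z := by
    rw [h.and_neg_and, ← h.neg_and_self]
    simpa only [h.neg_neg] using h.dual.or_neg_or ∼x z
  have and_or_neg : x ⋏ y ⋎ ∼x = ∼x ⋎ y := by
    simpa only [h.neg_neg] using h.dual.neg_or_and ∼x y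
  calc (x ⋏ y) ⋏ z = (x ⋏ y) ⋏ x ⋏ z := (h.and_and_and_left _ _ _).symm
    _ = (x ⋏ y ⋎ x ⋏ ∼x) ⋏ x ⋏ z := by rw [h.dual.or_and_or_neg]
    _ = (x ⋏ y ⋎ ∼x) ⋏ x ⋏ z := by rw [h.mem, h.mem, neg_and_and]
    _ = x ⋏ y ⋏ z := by rw [and_or_neg, h.neg_or_and_and]

theorem or_and_distrib (h : IsMemorising neg and or) (x y z : A) :
    (x ⋎ y) ⋏ (x ⋎ z) = x ⋎ y ⋏ z := by
  have and_or : ∼x ⋏ y ⋏ (x ⋎ z) = ∼x ⋏ y ⋏ z := by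
    have neg_and_or : ∼x ⋏ (x ⋎ z) = ∼x ⋏ z := by
      simpa only [h.neg_neg] using h.and_neg_or ∼x z
    rw [← h.and_and_and_self_left, neg_and_or, h.and_and_and_self_left]
  rw [h.mem, h.absorb, and_or, h.dual.neg_or_and]

theorem and_and_or (h : IsMemorising neg and or) (x y z : A) : x ⋏ y ⋏ (x ⋎ z) = x ⋏ y := by
  rw [← h.and_and_and_self_left, h.absorb, h.dual.or_or_self]

theorem or_and_neg_or (h : IsMemorising neg and or) (x y z : A) :
    (x ⋎ y) ⋏ (∼x ⋎ z) = ∼x ⋏ y ⋎ x ⋏ z := by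
  rw [h.mem, h.and_neg_or, h.and_and_or]

theorem or_or_or_swap (h : IsMemorising neg and or) (x y : A) : (x ⋎ y) ⋎ y ⋎ x = x ⋎ y := by
  rw [h.dual.and_assoc, h.dual.and_and_self_left, h.or_or_self]

theorem conditional_comm (h : IsMemorising neg and or) (x y z : A) :
    x ⋏ y ⋎ ∼x ⋏ z = ∼x ⋏ z ⋎ x ⋏ y := by
  have := h.com (∼x ⋎ y) (x ⋎ z)
  rwa [h.or_and_neg_or, ← h.dual.or_and_neg_or, h.or_or_or_swap, h.or_or_or_swap] at this

theorem isConditional (h : IsMemorising neg and or) : IsConditional neg and or where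
  neg_neg := h.neg_neg
  neg_and := h.neg_and
  and_assoc := h.and_assoc
  and_or_distrib x y z := (h.dual.or_and_distrib x y z).symm
  or_and x y z := by rw [h.mem, h.conditional_comm]
  absorb := h.dual.absorb
  com := h.com

end IsMemorising

namespace IsConditional

theorem neg_or (h : IsConditional neg and or) (x y : A) : ∼(x ⋎ y) = ∼x ⋏ ∼y := by
  rw [← h.neg_neg (∼x ⋏ ∼y), h.neg_and, h.neg_neg, h.neg_neg]

theorem dual (h : IsConditional neg and or) : IsConditional neg or and where
  neg_neg := h.neg_neg
  neg_and := h.neg_or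
  and_assoc x y z := by
    simpa only [h.neg_and, h.neg_neg] using congrArg neg (h.and_assoc ∼x ∼y ∼z)
  and_or_distrib x y z := by
    simpa only [h.neg_and, h.neg_or, h.neg_neg] using congrArg neg (h.and_or_distrib ∼x ∼y ∼z)
  or_and x y z := by
    simpa only [h.neg_and, h.neg_or, h.neg_neg] using congrArg neg (h.or_and ∼x ∼y ∼z)
  absorb x y := by
    simpa only [h.neg_and, h.neg_or, h.neg_neg] using congrArg neg (h.absorb ∼x ∼y)
  com x y := by
    simpa only [h.neg_and, h.neg_or, h.neg_neg] using congrArg neg (h.com ∼x ∼y)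

theorem and_self (h : IsConditional neg and or) (x : A) : x ⋏ x = x := by
  calc x ⋏ x = x ⋏ (x ⋎ x ⋏ x) := by rw [h.absorb]
    _ = x := h.dual.absorb x (x ⋏ x)

theorem and_and_self_left (h : IsConditional neg and or) (x y : A) : x ⋏ x ⋏ y = x ⋏ y := by
  rw [← h.and_assoc, h.and_self]

theorem and_and_self (h : IsConditional neg and or) (x y : A) : x ⋏ y ⋏ x = x ⋏ y := by
  have and_and_or : x ⋏ (y ⋏ x ⋎ y) = x ⋏ y := by
    calc x ⋏ (y ⋏ x ⋎ y) = (x ⋏ y) ⋏ x ⋎ x ⋏ x ⋏ y := by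
          rw [h.and_or_distrib, h.and_and_self_left, h.and_assoc]
      _ = x ⋏ x ⋏ y ⋎ (x ⋏ y) ⋏ x := h.com _ _
      _ = x ⋏ y := by rw [h.and_and_self_left, h.absorb]
  calc x ⋏ y ⋏ x = x ⋏ (y ⋏ x) ⋏ (y ⋏ x ⋎ y) := by rw [h.dual.absorb]
    _ = (x ⋏ y) ⋏ x ⋏ (y ⋏ x ⋎ y) := by simp only [h.and_assoc]
    _ = x ⋏ y := by rw [and_and_or, h.and_self]

theorem and_neg_or (h : IsConditional neg and or) (x y : A) : x ⋏ (∼x ⋎ y) = x ⋏ y := by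
  have and_or : x ⋏ y ⋎ y = (x ⋎ y) ⋏ (∼x ⋎ y) := by
    rw [h.dual.or_and, h.dual.and_self]
  calc x ⋏ (∼x ⋎ y) = x ⋏ (x ⋎ y) ⋏ (∼x ⋎ y) := by rw [← h.and_assoc, h.dual.absorb]
    _ = x ⋏ (x ⋏ y ⋎ y) := by rw [and_or]
    _ = x ⋏ y := by rw [h.and_or_distrib, h.and_and_self_left, h.dual.and_self]

theorem and_neg_and (h : IsConditional neg and or) (x y : A) : x ⋏ ∼x ⋏ y = x ⋏ ∼x := by
  rw [← h.and_neg_or, h.absorb]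

theorem and_and_self_and (h : IsConditional neg and or) (x y z : A) :
    x ⋏ y ⋏ x ⋏ z = x ⋏ y ⋏ z := by
  rw [← h.and_assoc y, ← h.and_assoc x, h.and_and_self, h.and_assoc]

theorem and_and_or (h : IsConditional neg and or) (x y z : A) : x ⋏ y ⋏ (x ⋎ z) = x ⋏ y := by
  rw [← h.and_and_self_and, h.dual.absorb, h.and_and_self]

theorem or_and_neg_or (h : IsConditional neg and or) (x y z : A) :
    (x ⋎ y) ⋏ (∼x ⋎ z) = x ⋏ z ⋎ ∼x ⋏ y := by
  rw [h.or_and, h.and_neg_or, h.and_and_or]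

theorem or_or_or_swap (h : IsConditional neg and or) (x y : A) : (x ⋎ y) ⋎ y ⋎ x = x ⋎ y := by
  rw [h.dual.and_assoc, h.dual.and_and_self_left, h.dual.and_and_self]

theorem conditional_comm (h : IsConditional neg and or) (x y z : A) :
    x ⋏ y ⋎ ∼x ⋏ z = ∼x ⋏ z ⋎ x ⋏ y := by
  have neg_or_and_or : (∼x ⋎ y) ⋏ (x ⋎ z) = ∼x ⋏ z ⋎ x ⋏ y := by
    simpa only [h.neg_neg] using h.or_and_neg_or ∼x y z
  have := h.com (∼x ⋎ y) (x ⋎ z)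
  rwa [h.or_and_neg_or, neg_or_and_or, h.or_or_or_swap, h.or_or_or_swap, eq_comm] at this

theorem isMemorising (h : IsConditional neg and or) : IsMemorising neg and or where
  neg_neg := h.neg_neg
  or_eq x y := by rw [← h.neg_or, h.neg_neg]
  absorb := h.dual.absorb
  mem x y z := by rw [h.or_and, h.conditional_comm]
  com := h.com

theorem or_neg_comm (h : IsConditional neg and or) (x : A) : x ⋎ ∼x = ∼x ⋎ x := by
  simpa only [h.and_self] using h.conditional_comm x x ∼x

theorem neg_conditional (h : IsConditional neg and or) (x y z : A) :
    ∼(x ⋏ y ⋎ ∼x ⋏ z) = x ⋏ ∼y ⋎ ∼x ⋏ ∼z := by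
  calc ∼(x ⋏ y ⋎ ∼x ⋏ z) = (∼x ⋎ ∼y) ⋏ (∼∼x ⋎ ∼z) := by rw [h.neg_or, h.neg_and, h.neg_and]
    _ = ∼x ⋏ ∼z ⋎ x ⋏ ∼y := by rw [h.or_and_neg_or, h.neg_neg]
    _ = x ⋏ ∼y ⋎ ∼x ⋏ ∼z := (h.conditional_comm x ∼y ∼z).symm

theorem conditional_and (h : IsConditional neg and or) (x y z w : A) :
    (x ⋏ y ⋎ ∼x ⋏ z) ⋏ w = x ⋏ y ⋏ w ⋎ ∼x ⋏ z ⋏ w := by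
  calc (x ⋏ y ⋎ ∼x ⋏ z) ⋏ w = (x ⋎ z) ⋏ (∼x ⋎ y) ⋏ w := by rw [← h.or_and_neg_or, h.and_assoc]
    _ = (x ⋏ (∼x ⋎ y)) ⋏ w ⋎ (∼x ⋏ z ⋏ (∼x ⋎ y)) ⋏ w := by rw [h.or_and]; simp only [h.and_assoc]
    _ = x ⋏ y ⋏ w ⋎ ∼x ⋏ z ⋏ w := by rw [h.and_neg_or, h.and_and_or, h.and_assoc, h.and_assoc]

theorem and_conditional (h : IsConditional neg and or) (x y z : A) :
    x ⋏ (x ⋏ y ⋎ ∼x ⋏ z) = x ⋏ y := by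
  calc x ⋏ (x ⋏ y ⋎ ∼x ⋏ z) = x ⋏ y ⋎ x ⋏ ∼x := by
        rw [h.and_or_distrib, h.and_and_self_left, h.and_neg_and]
    _ = x ⋏ y ⋎ ∼x ⋏ x := by rw [h.dual.or_neg_comm]
    _ = x ⋏ ∼x ⋎ x ⋏ y := by rw [h.conditional_comm, ← h.dual.or_neg_comm]
    _ = x ⋏ y := by rw [← h.and_or_distrib, h.and_neg_or]

theorem neg_and_conditional (h : IsConditional neg and or) (x y z : A) :
    ∼x ⋏ (x ⋏ y ⋎ ∼x ⋏ z) = ∼x ⋏ z := by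
  simpa only [h.neg_neg, h.conditional_comm x y z] using h.and_conditional ∼x z y

theorem and_conditional_and (h : IsConditional neg and or) (x y z w : A) :
    x ⋏ (y ⋏ x ⋏ z ⋎ ∼y ⋏ x ⋏ w) = x ⋏ (y ⋏ z ⋎ ∼y ⋏ w) := by
  rw [h.and_or_distrib, h.and_and_self_and, h.and_and_self_and, ← h.and_or_distrib]

theorem or_neg_and (h : IsConditional neg and or) (x y : A) :
    (x ⋎ ∼x) ⋏ y = x ⋏ y ⋎ ∼x ⋏ y := by
  rw [h.or_and, h.and_and_self_left]

theorem or_neg_or (h : IsConditional neg and or) (x y : A) : (x ⋎ ∼x) ⋎ y = x ⋎ ∼x := by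
  rw [h.dual.and_assoc, h.dual.and_neg_and]

theorem or_neg_and_self (h : IsConditional neg and or) (x : A) : (x ⋎ ∼x) ⋏ x = x := by
  rw [h.or_neg_and, h.and_self, ← h.dual.or_neg_comm, h.absorb]

theorem or_neg_and_conditional (h : IsConditional neg and or) (x y z : A) :
    (x ⋎ ∼x) ⋏ (x ⋏ y ⋎ ∼x ⋏ z) = x ⋏ y ⋎ ∼x ⋏ z := by
  rw [h.or_neg_and, h.and_conditional, h.neg_and_conditional]

theorem and_or_of_or (h : IsConditional neg and or) {x y : A} (hx : ∀ z, x ⋎ z = x)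
    (hy : ∀ z, y ⋎ z = y) (z : A) : x ⋏ y ⋎ z = x ⋏ y := by
  rw [h.dual.or_and, hx, hy, h.and_neg_or]

theorem and_comm_of_or (h : IsConditional neg and or) {x y : A} (hx : ∀ z, x ⋎ z = x)
    (hy : ∀ z, y ⋎ z = y) : x ⋏ y = y ⋏ x := by
  have := h.com x y
  rwa [h.and_or_of_or hx hy, h.and_or_of_or hy hx] at this

theorem or_neg_and_comm (h : IsConditional neg and or) (x y : A) :
    (x ⋎ ∼x) ⋏ (y ⋎ ∼y) = (y ⋎ ∼y) ⋏ (x ⋎ ∼x) :=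
  h.and_comm_of_or (h.or_neg_or x) (h.or_neg_or y)

theorem neg_or_of_or (h : IsConditional neg and or) {e : A} (he : ∀ z, e ⋎ z = e) (x : A) :
    ∼e ⋎ x = e ⋏ x := by
  have neg_and_self : ∼e ⋏ e = ∼e := by
    simpa only [h.neg_or, h.neg_neg] using congrArg neg (he ∼e)
  calc ∼e ⋎ x = e ⋏ ∼e ⋎ x := by rw [h.dual.or_neg_comm, neg_and_self]
    _ = (e ⋎ x) ⋏ (∼e ⋎ ∼e ⋎ x) := h.dual.or_and e ∼e x
    _ = e ⋏ x := by rw [he, h.dual.and_and_self_left, h.and_neg_or]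

theorem neg_and_of_or (h : IsConditional neg and or) {e : A} (he : ∀ z, e ⋎ z = e) (x : A) :
    ∼(e ⋏ x) = e ⋏ ∼x := by
  rw [h.neg_and, h.neg_or_of_or he]

-- The tests `x ∨ ¬x` and `y ∨ ¬y` commute, and a conditional on `y` absorbs the latter.
theorem conditional_or_neg_and (h : IsConditional neg and or) (x y z w : A) :
    y ⋏ (x ⋎ ∼x) ⋏ z ⋎ ∼y ⋏ (x ⋎ ∼x) ⋏ w = (x ⋎ ∼x) ⋏ (y ⋏ z ⋎ ∼y ⋏ w) := by
  have and_or_neg_and (t c : A) :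
      t ⋏ (x ⋎ ∼x) ⋏ c = t ⋏ (x ⋎ ∼x) ⋏ t ⋏ c := (h.and_and_self_and _ _ _).symm
  calc y ⋏ (x ⋎ ∼x) ⋏ z ⋎ ∼y ⋏ (x ⋎ ∼x) ⋏ w
      = y ⋏ (x ⋎ ∼x) ⋏ (y ⋏ z ⋎ ∼y ⋏ w) ⋎ ∼y ⋏ (x ⋎ ∼x) ⋏ (y ⋏ z ⋎ ∼y ⋏ w) := by
        rw [and_or_neg_and y (y ⋏ z ⋎ ∼y ⋏ w), h.and_conditional, ← and_or_neg_and,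
          and_or_neg_and ∼y (y ⋏ z ⋎ ∼y ⋏ w), h.neg_and_conditional, ← and_or_neg_and]
    _ = ((y ⋎ ∼y) ⋏ (x ⋎ ∼x)) ⋏ (y ⋏ z ⋎ ∼y ⋏ w) := by rw [← h.or_neg_and, h.and_assoc]
    _ = (x ⋎ ∼x) ⋏ (y ⋏ z ⋎ ∼y ⋏ w) := by
        rw [h.or_neg_and_comm, h.and_assoc, h.or_neg_and_conditional]

theorem and_of_neg_eq (h : IsConditional neg and or) {u : A} (hu : ∼u = u) (x : A) :
    u ⋏ x = u := by
  simpa only [hu, h.and_and_self_left, h.and_self] using h.and_neg_and u x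

theorem or_neg_and_of_neg_eq (h : IsConditional neg and or) {u : A} (hu : ∼u = u) (x : A) :
    (x ⋎ ∼x) ⋏ u = u := by
  simpa only [hu, h.dual.and_self, h.and_of_neg_eq hu] using h.or_neg_and_comm x u

theorem and_one (h : IsConditional neg and or) {e : A} (he : ∀ x, e ⋏ x = x) (x : A) :
    x ⋏ e = x := by
  rw [← he (x ⋏ e), h.and_and_self, he]

theorem zero_and (h : IsConditional neg and or) {e : A} (he : ∀ x, e ⋏ x = x) (x : A) :
    ∼e ⋏ x = ∼e := by
  have one_or : e ⋎ ∼x = e := by rw [← he (e ⋎ ∼x), h.dual.absorb]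
  simpa only [h.neg_or, h.neg_neg] using congrArg neg one_or

theorem or_zero (h : IsConditional neg and or) {e : A} (he : ∀ x, e ⋏ x = x) (x : A) :
    x ⋎ ∼e = x := by
  simpa only [h.neg_and, h.neg_neg] using congrArg neg (h.and_one he ∼x)

theorem conditional_one_zero (h : IsConditional neg and or) {e : A} (he : ∀ x, e ⋏ x = x)
    (x : A) : x ⋏ e ⋎ ∼x ⋏ ∼e = x := by
  rw [h.and_one he, h.dual.and_neg_or, h.or_zero he]

end IsConditional

theorem neg_neg_of_one_and (or_eq : ∀ x y, x ⋎ y = ∼(∼x ⋏ ∼y)) (absorb : ∀ x y, x ⋏ (x ⋎ y) = x)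
    (mem : ∀ x y z, (x ⋎ y) ⋏ z = ∼x ⋏ y ⋏ z ⋎ x ⋏ z) {e : A} (one_and : ∀ x, e ⋏ x = x) (x : A) :
    ∼∼x = x := by
  have one_or (y : A) : e ⋎ y = e := by rw [← one_and (e ⋎ y), absorb]
  have neg_and_or (y : A) : ∼e ⋏ y ⋎ y = y := by
    simpa only [one_or, one_and] using (mem e e y).symm
  have neg_neg_and_neg (y : A) : ∼(∼e ⋏ ∼y) = e := by rw [← or_eq, one_or]
  obtain ⟨y, rfl⟩ : ∃ y, ∼y = x := ⟨_, (or_eq _ _).symm.trans (neg_and_or x)⟩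
  calc ∼∼∼y = ∼(∼(∼e ⋏ ∼y) ⋏ ∼∼y) := by rw [neg_neg_and_neg, one_and]
    _ = ∼e ⋏ ∼y ⋎ ∼y := (or_eq _ _).symm
    _ = ∼y := neg_and_or _

end Operations

/-! ### Algebras over the signature -/

/-- Algebras with carrier `A` over the signature of `Term S`. -/
structure Alg (S : Set TV) (A : Type*) where
  neg : A → A
  and : A → A → A
  or : A → A → A
  const : S → A

/-- The value of a term in an algebra under a valuation of its variables. -/
def Term.interp {S : Set TV} {A X : Type*} (M : Alg S A) (v : X → A) : Term S X → A
  | var x => v x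
  | const c => M.const c
  | neg t => M.neg (t.interp M v)
  | and s t => M.and (s.interp M v) (t.interp M v)
  | or s t => M.or (s.interp M v) (t.interp M v)

/-- The algebra `C`, as an algebra over the signature of `Term S`. -/
def standard (S : Set TV) : Alg S TV where
  neg := TV.neg
  and := TV.and
  or := TV.or
  const c := c

/-- The absolutely free algebra of terms over `X`. -/
def termAlg (S : Set TV) (X : Type*) : Alg S (Term S X) where
  neg := .neg
  and := .and
  or := .or
  const := .const

namespace Alg

variable {S : Set TV} {A B : Type*}

/-- The algebra `M` satisfies the equation `q`. -/
def Sat (M : Alg S A) (q : Equation S) : Prop :=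
  ∀ v : ℕ → A, q.lhs.interp M v = q.rhs.interp M v

/-- The algebra over a smaller signature that results from forgetting constants. -/
def reduct {S' : Set TV} (M : Alg S' A) (h : S ⊆ S') : Alg S A where
  neg := M.neg
  and := M.and
  or := M.or
  const c := M.const (Set.inclusion h c)

/-- `f` is a homomorphism of algebras from `M` to `N`. -/
structure IsHom (M : Alg S A) (N : Alg S B) (f : A → B) : Prop where
  map_neg x : f (M.neg x) = N.neg (f x)
  map_and x y : f (M.and x y) = N.and (f x) (f y)
  map_or x y : f (M.or x y) = N.or (f x) (f y)
  map_const c : f (M.const c) = N.const c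

theorem IsHom.map_interp {M : Alg S A} {N : Alg S B} {f : A → B} (hf : IsHom M N f) {X : Type*}
    (v : X → A) (t : Term S X) : f (t.interp M v) = t.interp N (f ∘ v) := by
  induction t with
  | var x => rfl
  | const c => exact hf.map_const c
  | neg t ht => simp only [Term.interp, hf.map_neg, ht]
  | and s t hs ht => simp only [Term.interp, hf.map_and, hs, ht]
  | or s t hs ht => simp only [Term.interp, hf.map_or, hs, ht]

theorem isHom_interp (M : Alg S A) {X : Type*} (v : X → A) :
    IsHom (termAlg S X) M (Term.interp M v) :=
  ⟨fun _ => rfl, fun _ _ => rfl, fun _ _ => rfl, fun _ => rfl⟩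

/-- The algebra `M` is a C-algebra and its constants satisfy `T ∧ x = x`, `¬T = F` and `¬U = U`, as
far as they are present. -/
structure IsModel (M : Alg S A) : Prop where
  isConditional : IsConditional M.neg M.and M.or
  true_and hT x : M.and (M.const ⟨TV.T, hT⟩) x = x
  neg_true hT hF : M.neg (M.const ⟨TV.T, hT⟩) = M.const ⟨TV.F, hF⟩
  neg_undef hU : M.neg (M.const ⟨TV.U, hU⟩) = M.const ⟨TV.U, hU⟩

end Alg

instance : Fintype TV := ⟨{TV.T, TV.F, TV.U}, by rintro (_ | _ | _) <;> decide⟩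

theorem isMemorising_standard : IsMemorising TV.neg TV.and TV.or where
  neg_neg := by decide
  or_eq := by decide
  absorb := by decide
  mem := by decide
  com := by decide

theorem isModel_standard (S : Set TV) : (standard S).IsModel where
  isConditional := isMemorising_standard.isConditional
  true_and _ _ := rfl
  neg_true _ _ := rfl
  neg_undef _ := rfl

namespace Term

variable {S : Set TV}

theorem interp_standard {X : Type*} (v : X → TV) (t : Term S X) :
    t.interp (standard S) v = t.eval v := by
  induction t with
  | var x => rfl
  | const c => rfl
  | neg t ht => exact congrArg TV.neg ht
  | and s t hs ht => exact congrArg₂ TV.and hs ht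
  | or s t hs ht => exact congrArg₂ TV.or hs ht

theorem interp_termAlg {X : Type} {Y : Type*} (σ : X → Term S Y) (t : Term S X) :
    t.interp (termAlg S Y) σ = t.subst σ := by
  induction t with
  | var x => rfl
  | const c => rfl
  | neg t ht => exact congrArg neg ht
  | and s t hs ht => exact congrArg₂ and hs ht
  | or s t hs ht => exact congrArg₂ or hs ht

theorem interp_termAlg_var {X : Type*} (t : Term S X) : t.interp (termAlg S X) var = t := by
  induction t with
  | var x => rfl
  | const c => rfl
  | neg t ht => exact congrArg neg ht
  | and s t hs ht => exact congrArg₂ and hs ht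
  | or s t hs ht => exact congrArg₂ or hs ht

theorem interp_subst {X : Type} {Y A : Type*} (M : Alg S A) (σ : X → Term S Y) (v : Y → A)
    (t : Term S X) : (t.subst σ).interp M v = t.interp M fun x => (σ x).interp M v := by
  rw [← interp_termAlg, (M.isHom_interp v).map_interp, Function.comp_def]

end Term

/-! ### Decision trees -/

/-- The signature with constants for `T` and `F`, which the leaves of a decision tree need. -/
abbrev adjoinTF (S : Set TV) : Set TV := insert TV.T (insert TV.F S)

theorem subset_adjoinTF (S : Set TV) : S ⊆ adjoinTF S :=
  (Set.subset_insert _ _).trans (Set.subset_insert _ _)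

theorem true_mem_adjoinTF (S : Set TV) : TV.T ∈ adjoinTF S := .inl rfl

theorem false_mem_adjoinTF (S : Set TV) : TV.F ∈ adjoinTF S := .inr (.inl rfl)

theorem neg_mem_adjoinTF {S : Set TV} {c : TV} (hc : c ∈ adjoinTF S) : c.neg ∈ adjoinTF S := by
  match c, hc with
  | TV.T, _ => exact false_mem_adjoinTF S
  | TV.F, _ => exact true_mem_adjoinTF S
  | TV.U, hU => exact hU

namespace Alg

variable {S : Set TV} {A : Type*} {M : Alg S A}

theorem IsModel.neg_const (hM : M.IsModel) {c : TV} (hc : c ∈ S) (hc' : c.neg ∈ S) :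
    M.neg (M.const ⟨c, hc⟩) = M.const ⟨c.neg, hc'⟩ := by
  match c with
  | TV.T => exact hM.neg_true hc hc'
  | TV.F => rw [← hM.neg_true hc' hc, hM.isConditional.neg_neg]; rfl
  | TV.U => exact hM.neg_undef hc

theorem IsModel.const_and (hM : M.IsModel) (hT : TV.T ∈ S) (c : S) (x : A) :
    M.and (M.const c) x = if c = ⟨TV.T, hT⟩ then x else M.const c := by
  obtain ⟨_ | _ | _, hc⟩ := c
  · exact hM.true_and hT x
  · simpa [← hM.neg_true hT hc] using hM.isConditional.zero_and (hM.true_and hT) x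
  · simpa using hM.isConditional.and_of_neg_eq (hM.neg_undef hc) x

end Alg

/-- Decision trees: a node `node x l r` asks for the value of `x` and continues with `l` if it is
`T`, with `r` if it is `F`; it is undefined if `x` is. -/
inductive Tree (S : Set TV) (X : Type u) : Type u
  | leaf (c : adjoinTF S) : Tree S X
  | node (x : X) (l r : Tree S X) : Tree S X

namespace Tree

variable {S : Set TV} {X : Type u}

/-- The value of a decision tree in an algebra under a valuation of its variables. -/
def interp {A : Type*} (M : Alg (adjoinTF S) A) (v : X → A) : Tree S X → A
  | leaf c => M.const c
  | node x l r => M.or (M.and (v x) (l.interp M v)) (M.and (M.neg (v x)) (r.interp M v))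

/-- The number of inner nodes, on which the inductions on pairs of trees proceed. -/
def size : Tree S X → ℕ
  | leaf _ => 0
  | node _ l r => l.size + r.size + 1

/-- Negation of a decision tree. -/
def neg : Tree S X → Tree S X
  | leaf c => leaf ⟨c.1.neg, neg_mem_adjoinTF c.2⟩
  | node x l r => node x l.neg r.neg

/-- Conjunction of decision trees: the second tree is grafted onto the `T`-leaves of the first. -/
def and : Tree S X → Tree S X → Tree S X
  | leaf c, t => if c = ⟨TV.T, true_mem_adjoinTF S⟩ then t else leaf c
  | node x l r, t => node x (l.and t) (r.and t)

/-- The tree that remains once `x` is known to be `T` (for `b = true`) or `F` (for `b = false`). -/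
def restrict [DecidableEq X] (x : X) (b : Bool) : Tree S X → Tree S X
  | leaf c => leaf c
  | node y l r =>
    if y = x then bif b then l.restrict x b else r.restrict x b
    else node y (l.restrict x b) (r.restrict x b)

section Interp

variable {A : Type*} {M : Alg (adjoinTF S) A}

theorem interp_neg (hM : M.IsModel) (v : X → A) (t : Tree S X) :
    t.neg.interp M v = M.neg (t.interp M v) := by
  induction t with
  | leaf c => exact (hM.neg_const c.2 _).symm
  | node x l r hl hr => simp only [neg, interp, hl, hr, hM.isConditional.neg_conditional]

theorem interp_and (hM : M.IsModel) (v : X → A) (s t : Tree S X) :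
    (s.and t).interp M v = M.and (s.interp M v) (t.interp M v) := by
  induction s with
  | leaf c => rw [and, apply_ite (interp M v), interp, hM.const_and (true_mem_adjoinTF S)]
  | node x l r hl hr => simp only [and, interp, hl, hr, hM.isConditional.conditional_and]

variable [DecidableEq X]

theorem and_interp_restrict (h : IsConditional M.neg M.and M.or) (v : X → A) (x : X) (b : Bool)
    (t : Tree S X) :
    M.and (bif b then v x else M.neg (v x)) ((t.restrict x b).interp M v) =
      M.and (bif b then v x else M.neg (v x)) (t.interp M v) := by
  induction t with
  | leaf c => rfl
  | node y l r hl hr =>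
    by_cases hy : y = x
    · subst hy
      cases b
      · simpa [restrict, interp, h.neg_and_conditional] using hr
      · simpa [restrict, interp, h.and_conditional] using hl
    · rw [restrict, if_neg hy, interp, ← h.and_conditional_and, hl, hr, h.and_conditional_and,
        interp]

theorem or_neg_and_interp_restrict (h : IsConditional M.neg M.and M.or) (v : X → A) (x : X)
    (t : Tree S X) :
    M.or (M.and (v x) ((t.restrict x true).interp M v))
        (M.and (M.neg (v x)) ((t.restrict x false).interp M v)) =
      M.and (M.or (v x) (M.neg (v x))) (t.interp M v) := by
  rw [h.or_neg_and]
  exact congrArg₂ M.or (and_interp_restrict h v x true t) (and_interp_restrict h v x false t)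

end Interp

section Restrict

variable [DecidableEq X]

theorem size_restrict_le (x : X) (b : Bool) (t : Tree S X) : (t.restrict x b).size ≤ t.size := by
  induction t with
  | leaf c => rfl
  | node y l r hl hr =>
    by_cases hy : y = x <;> cases b <;> simp only [restrict, hy, if_true, if_false, cond_true,
      cond_false, size] <;> omega

theorem size_restrict_node_lt (x : X) (b : Bool) (l r : Tree S X) :
    ((node x l r).restrict x b).size < (node x l r).size := by
  have hl := size_restrict_le x b l
  have hr := size_restrict_le x b r
  cases b <;> simp only [restrict, if_true, cond_true, cond_false, size] <;> omega

theorem interp_standard_restrict (w : X → TV) (x : X) (b : Bool) (t : Tree S X) :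
    (t.restrict x b).interp (standard _) w =
      t.interp (standard _) (Function.update w x (bif b then TV.T else TV.F)) := by
  induction t with
  | leaf c => rfl
  | node y l r hl hr =>
    by_cases hy : y = x
    · subst hy
      have one (a c : TV) : (TV.T.and a).or (TV.T.neg.and c) = a := by cases a <;> rfl
      have zero (a c : TV) : (TV.F.and a).or (TV.F.neg.and c) = c := rfl
      cases b
      · simpa [restrict, interp, standard, zero] using hr
      · simpa [restrict, interp, standard, one] using hl
    · simp only [restrict, if_neg hy, interp, hl, hr, Function.update_of_ne hy]

end Restrict

theorem interp_standard_node {x : X} {w : X → TV} (hw : w x = TV.U) (l r : Tree S X) :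
    (node x l r).interp (standard _) w = TV.U := by
  rw [interp, hw]; rfl

section Completeness

variable {A : Type*} {M : Alg (adjoinTF S) A}

theorem interp_node_eq_restrict [DecidableEq X] (h : IsConditional M.neg M.and M.or) (v : X → A)
    (x : X) (l r : Tree S X) :
    (node x l r).interp M v =
      M.or (M.and (v x) (((node x l r).restrict x true).interp M v))
        (M.and (M.neg (v x)) (((node x l r).restrict x false).interp M v)) := by
  rw [or_neg_and_interp_restrict h, interp, h.or_neg_and_conditional]

theorem or_neg_and_interp (hM : M.IsModel) (v : X → A) (x : X) (t : Tree S X)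
    (ht : ∀ w, w x = TV.U → t.interp (standard _) w = TV.U) :
    M.and (M.or (v x) (M.neg (v x))) (t.interp M v) = t.interp M v := by
  classical
  have h := hM.isConditional
  induction hn : t.size using Nat.strong_induction_on generalizing t with
  | _ n ih =>
  match t with
  | leaf c =>
    obtain ⟨c, hc⟩ := c
    obtain rfl : c = TV.U := ht (fun _ => TV.U) rfl
    exact h.or_neg_and_of_neg_eq (hM.neg_undef hc) (v x)
  | node y l r =>
    by_cases hyx : y = x
    · subst hyx
      exact h.or_neg_and_conditional _ _ _
    · have restrict_eq (b : Bool) :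
          M.and (M.or (v x) (M.neg (v x))) (((node y l r).restrict y b).interp M v) =
            ((node y l r).restrict y b).interp M v :=
        ih _ (hn ▸ size_restrict_node_lt y b l r) _ (fun w hw => by
          rw [interp_standard_restrict, ht _ ((Function.update_of_ne (Ne.symm hyx) _ _).trans hw)])
          rfl
      rw [interp_node_eq_restrict h, ← h.conditional_or_neg_and, restrict_eq, restrict_eq]

theorem interp_eq_of_restrict [DecidableEq X] (hM : M.IsModel) (v : X → A) (x : X)
    {s t : Tree S X}
    (hs : ∀ w, w x = TV.U → s.interp (standard _) w = TV.U)
    (ht : ∀ w, w x = TV.U → t.interp (standard _) w = TV.U)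
    (hst : ∀ b, (s.restrict x b).interp M v = (t.restrict x b).interp M v) :
    s.interp M v = t.interp M v := by
  have h := hM.isConditional
  rw [← or_neg_and_interp hM v x s hs, ← or_neg_and_interp_restrict h, hst, hst,
    or_neg_and_interp_restrict h, or_neg_and_interp hM v x t ht]

theorem interp_eq_of_interp_standard_eq (hM : M.IsModel) (v : X → A) (s t : Tree S X)
    (hst : ∀ w, s.interp (standard _) w = t.interp (standard _) w) :
    s.interp M v = t.interp M v := by
  classical
  induction hn : s.size + t.size using Nat.strong_induction_on generalizing s t with
  | _ n ih =>
  have restrict_eq (x : X) (b : Bool) (hlt : (s.restrict x b).size + (t.restrict x b).size < n) :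
      (s.restrict x b).interp M v = (t.restrict x b).interp M v :=
    ih _ hlt _ _ (fun w => by rw [interp_standard_restrict, interp_standard_restrict, hst]) rfl
  match s, t with
  | leaf c, leaf d => exact congrArg M.const (Subtype.ext (hst fun _ => TV.U))
  | node x l r, t =>
    refine interp_eq_of_restrict hM v x (fun w hw => interp_standard_node hw l r)
      (fun w hw => (hst w).symm.trans (interp_standard_node hw l r)) fun b => restrict_eq x b ?_
    exact hn ▸ add_lt_add_of_lt_of_le (size_restrict_node_lt x b l r) (size_restrict_le x b t)
  | s, node x l r =>
    refine interp_eq_of_restrict hM v x (fun w hw => (hst w).trans (interp_standard_node hw l r))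
      (fun w hw => interp_standard_node hw l r) fun b => restrict_eq x b ?_
    exact hn ▸ add_lt_add_of_le_of_lt (size_restrict_le x b s) (size_restrict_node_lt x b l r)

end Completeness

end Tree

namespace Term

variable {S : Set TV} {X : Type u}

/-- The decision tree that evaluates a term from left to right. -/
def toTree : Term S X → Tree S X
  | var x => .node x (.leaf ⟨TV.T, true_mem_adjoinTF S⟩) (.leaf ⟨TV.F, false_mem_adjoinTF S⟩)
  | const c => .leaf ⟨c, subset_adjoinTF S c.2⟩
  | neg t => t.toTree.neg
  | and s t => s.toTree.and t.toTree
  | or s t => (s.toTree.neg.and t.toTree.neg).neg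

variable {A : Type*} {M : Alg (adjoinTF S) A}

theorem interp_toTree (hM : M.IsModel) (v : X → A) (t : Term S X) :
    t.toTree.interp M v = t.interp (M.reduct (subset_adjoinTF S)) v := by
  have h := hM.isConditional
  induction t with
  | var x =>
    rw [toTree, Tree.interp, Tree.interp, Tree.interp,
      ← hM.neg_true (true_mem_adjoinTF S) (false_mem_adjoinTF S)]
    exact h.conditional_one_zero (hM.true_and _) (v x)
  | const c => rfl
  | neg t ht => rw [toTree, Tree.interp_neg hM, ht]; rfl
  | and s t hs ht => rw [toTree, Tree.interp_and hM, hs, ht]; rfl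
  | or s t hs ht =>
    rw [toTree, Tree.interp_neg hM, Tree.interp_and hM, Tree.interp_neg hM, Tree.interp_neg hM,
      hs, ht, h.neg_and, h.neg_neg, h.neg_neg]
    rfl

theorem interp_reduct_eq_of_valid (hM : M.IsModel) {s t : Term S X} (hst : Valid s t)
    (v : X → A) :
    s.interp (M.reduct (subset_adjoinTF S)) v = t.interp (M.reduct (subset_adjoinTF S)) v := by
  classical
  have toTree_standard (w : X → TV) (r : Term S X) :
      r.toTree.interp (standard (adjoinTF S)) w = r.eval w :=
    (interp_toTree (isModel_standard _) w r).trans (interp_standard w r)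
  rw [← interp_toTree hM, ← interp_toTree hM]
  exact Tree.interp_eq_of_interp_standard_eq hM v _ _ fun w => by
    rw [toTree_standard, toTree_standard, hst w]

end Term

/-! ### Localisation -/

namespace Alg

variable {S : Set TV} {A : Type*} {M : Alg S A}

theorem undef_mem_of_mem_adjoinTF (hU : TV.U ∈ adjoinTF S) : TV.U ∈ S := by
  simpa [adjoinTF] using hU

/-- The projection of `M` onto the carrier of its localisation at `e`. -/
def toLocalise (M : Alg S A) (h : IsConditional M.neg M.and M.or) (e x : A) :
    {x // M.and e x = x} :=
  ⟨M.and e x, h.and_and_self_left e x⟩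

/-- The localisation of `M` at `e`: the elements `x` with `e ∧ x = x` form an algebra in which `e`
plays the role of `T`, provided that `e` itself is nowhere `F`, which `he` expresses. It has
constants for `T` and `F` whether or not `M` has, so that decision trees have values in it. -/
def localise (M : Alg S A) (h : IsConditional M.neg M.and M.or) {e : A}
    (he : ∀ x, M.or e x = e) : Alg (adjoinTF S) {x // M.and e x = x} where
  neg x := ⟨M.neg x, by rw [← h.neg_and_of_or he, x.2]⟩
  and x y := ⟨M.and x y, by rw [← h.and_assoc, x.2]⟩
  or x y := ⟨M.or x y, by rw [h.and_or_distrib, x.2, y.2]⟩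
  const
    | ⟨TV.T, _⟩ => ⟨e, h.and_self e⟩
    | ⟨TV.F, _⟩ => ⟨M.neg e, by rw [← h.neg_and_of_or he, h.and_self]⟩
    | ⟨TV.U, hU⟩ => M.toLocalise h e (M.const ⟨TV.U, undef_mem_of_mem_adjoinTF hU⟩)

theorem IsModel.localise (hM : M.IsModel) {e : A} (he : ∀ x, M.or e x = e) :
    (M.localise hM.isConditional he).IsModel :=
  have h := hM.isConditional
  { isConditional :=
      { neg_neg _ := Subtype.ext (h.neg_neg _)
        neg_and _ _ := Subtype.ext (h.neg_and _ _)
        and_assoc _ _ _ := Subtype.ext (h.and_assoc _ _ _)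
        and_or_distrib _ _ _ := Subtype.ext (h.and_or_distrib _ _ _)
        or_and _ _ _ := Subtype.ext (h.or_and _ _ _)
        absorb _ _ := Subtype.ext (h.absorb _ _)
        com _ _ := Subtype.ext (h.com _ _) }
    true_and _ x := Subtype.ext x.2
    neg_true _ _ := rfl
    neg_undef _ := Subtype.ext <|
      (h.neg_and_of_or he _).trans (congrArg (M.and e) (hM.neg_undef _)) }

theorem IsModel.isHom_toLocalise (hS : TV.F ∈ S → TV.T ∈ S) (hM : M.IsModel) {e : A}
    (he : ∀ x, M.or e x = e) :
    IsHom M ((M.localise hM.isConditional he).reduct (subset_adjoinTF S))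
      (M.toLocalise hM.isConditional e) :=
  have h := hM.isConditional
  have and_true (hT : TV.T ∈ S) : M.and e (M.const ⟨TV.T, hT⟩) = e := h.and_one (hM.true_and hT) e
  have and_false (hF : TV.F ∈ S) : M.and e (M.const ⟨TV.F, hF⟩) = M.neg e := by
    rw [← hM.neg_true (hS hF) hF, ← h.neg_and_of_or he, and_true]
  have and_and (x y : A) : M.and e (M.and x y) = M.and (M.and e x) (M.and e y) := by
    rw [h.and_assoc, h.and_and_self_and]
  { map_neg x := Subtype.ext (h.neg_and_of_or he x).symm
    map_and x y := Subtype.ext (and_and x y)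
    map_or x y := Subtype.ext (h.and_or_distrib e x y)
    map_const
      | ⟨TV.T, hT⟩ => Subtype.ext (and_true hT)
      | ⟨TV.F, hF⟩ => Subtype.ext (and_false hF)
      | ⟨TV.U, _⟩ => rfl }

end Alg

namespace Term

variable {S : Set TV} {X : Type u} {A : Type*} {M : Alg S A}

theorem and_interp_eq_of_valid (hS : TV.F ∈ S → TV.T ∈ S) (hM : M.IsModel) {e : A}
    (he : ∀ x, M.or e x = e) {s t : Term S X} (hst : Valid s t) (v : X → A) :
    M.and e (s.interp M v) = M.and e (t.interp M v) := by
  have hom := hM.isHom_toLocalise hS he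
  have localise_eq := interp_reduct_eq_of_valid (hM.localise he) hst
    (M.toLocalise hM.isConditional e ∘ v)
  rw [← hom.map_interp, ← hom.map_interp] at localise_eq
  exact congrArg Subtype.val localise_eq

/-- The value of the variable or constant that the evaluation of a term inspects first. -/
def head (M : Alg S A) (v : X → A) : Term S X → A
  | var x => v x
  | const c => M.const c
  | neg t => t.head M v
  | and s _ => s.head M v
  | or s _ => s.head M v

theorem or_neg_head_and_interp (h : IsConditional M.neg M.and M.or) (v : X → A) (t : Term S X) :
    M.and (M.or (t.head M v) (M.neg (t.head M v))) (t.interp M v) = t.interp M v := by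
  induction t with
  | var x => exact h.or_neg_and_self _
  | const c => exact h.or_neg_and_self _
  | neg t ht => rw [interp, head, ← h.neg_and_of_or (h.or_neg_or _), ht]
  | and s t hs _ => rw [interp, head, ← h.and_assoc, hs]
  | or s t hs _ =>
    rw [interp, head, ← h.neg_or_of_or (h.or_neg_or _), ← h.dual.and_assoc,
      h.neg_or_of_or (h.or_neg_or _), hs]

theorem interp_eq_of_valid (hS : TV.F ∈ S → TV.T ∈ S) (hM : M.IsModel) {s t : Term S X}
    (hst : Valid s t) (v : X → A) : s.interp M v = t.interp M v := by
  have h := hM.isConditional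
  set e := M.or (s.head M v) (M.neg (s.head M v))
  set f := M.or (t.head M v) (M.neg (t.head M v))
  have and_s : M.and e (s.interp M v) = s.interp M v := or_neg_head_and_interp h v s
  have and_t : M.and f (t.interp M v) = t.interp M v := or_neg_head_and_interp h v t
  have e_and : M.and e (s.interp M v) = M.and e (t.interp M v) :=
    and_interp_eq_of_valid hS hM (h.or_neg_or _) hst v
  have f_and : M.and f (s.interp M v) = M.and f (t.interp M v) :=
    and_interp_eq_of_valid hS hM (h.or_neg_or _) hst v
  calc s.interp M v = M.and (M.and e f) (t.interp M v) := by rw [h.and_assoc, and_t, ← e_and, and_s]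
    _ = M.and (M.and f e) (t.interp M v) := by rw [h.or_neg_and_comm]
    _ = M.and f (s.interp M v) := by rw [h.and_assoc, ← e_and, and_s]
    _ = t.interp M v := f_and.trans and_t

end Term

/-! ### Soundness and completeness -/

namespace Derivable

variable {S : Set TV} {E : Set (Equation S)} {X : Type u}

theorem interp_eq {A : Type*} {M : Alg S A} (hM : ∀ q ∈ E, M.Sat q) {s t : Term S X}
    (h : Derivable E s t) (v : X → A) : s.interp M v = t.interp M v := by
  induction h with
  | ax q hq σ => rw [Term.interp_subst, Term.interp_subst]; exact hM q hq _
  | refl t => rfl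
  | symm _ ih => exact ih.symm
  | trans _ _ ih₁ ih₂ => exact ih₁.trans ih₂
  | neg _ ih => exact congrArg M.neg ih
  | and _ _ ih₁ ih₂ => exact congrArg₂ M.and ih₁ ih₂
  | or _ _ ih₁ ih₂ => exact congrArg₂ M.or ih₁ ih₂

theorem not_of_sat {A : Type*} {M : Alg S A} {q : Equation S}
    (hM : ∀ r ∈ E, r ≠ q → M.Sat r) (hq : ¬ M.Sat q) : ¬ Derivable (E \ {q}) q.lhs q.rhs :=
  fun h => hq fun v => h.interp_eq (fun r hr => hM r hr.1 hr.2) v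

variable (E X)

/-- Derivable equality of terms. -/
def setoid : Setoid (Term S X) := ⟨Derivable E, refl, symm, trans⟩

/-- The free algebra on `X` of the class of algebras that satisfy the equations `E`: the terms over
`X` modulo derivable equality. -/
def freeAlg : Alg S (Quotient (setoid E X)) where
  neg := Quotient.map Term.neg fun _ _ => neg
  and := Quotient.map₂ Term.and fun _ _ h₁ _ _ h₂ => and h₁ h₂
  or := Quotient.map₂ Term.or fun _ _ h₁ _ _ h₂ => or h₁ h₂
  const c := Quotient.mk _ (.const c)

theorem isHom_mk : (termAlg S X).IsHom (freeAlg E X) (Quotient.mk (setoid E X)) :=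
  ⟨fun _ => rfl, fun _ _ => rfl, fun _ _ => rfl, fun _ => rfl⟩

variable {E X}

theorem interp_freeAlg {Y : Type} (σ : Y → Term S X) (t : Term S Y) :
    t.interp (freeAlg E X) (Quotient.mk _ ∘ σ) = Quotient.mk _ (t.subst σ) := by
  rw [← (isHom_mk E X).map_interp, Term.interp_termAlg]

theorem interp_freeAlg_var (t : Term S X) :
    t.interp (freeAlg E X) (Quotient.mk _ ∘ .var) = Quotient.mk _ t := by
  rw [← (isHom_mk E X).map_interp, Term.interp_termAlg_var]

theorem sat_freeAlg {q : Equation S} (hq : q ∈ E) : (freeAlg E X).Sat q := by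
  intro v
  obtain ⟨σ, rfl⟩ : ∃ σ : ℕ → Term S X, Quotient.mk _ ∘ σ = v :=
    ⟨Quotient.out ∘ v, funext fun i => Quotient.out_eq (v i)⟩
  rw [interp_freeAlg, interp_freeAlg]
  exact Quotient.sound (ax q hq σ)

theorem iff_valid (hS : TV.F ∈ S → TV.T ∈ S) (hE : ∀ q ∈ E, (standard S).Sat q)
    (hfree : (freeAlg E X).IsModel) {s t : Term S X} : Derivable E s t ↔ Valid s t := by
  constructor
  · intro h v
    simpa only [Term.interp_standard] using h.interp_eq hE v
  · intro h
    have interp_eq := Term.interp_eq_of_valid hS hfree h (Quotient.mk _ ∘ .var)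
    rw [interp_freeAlg_var, interp_freeAlg_var] at interp_eq
    exact Quotient.exact interp_eq

end Derivable

/-! ### Axiom systems -/

namespace Alg

variable {S : Set TV} {A : Type*} {M : Alg S A}

/-- The valuation of the variables `x`, `y`, `z` of the axioms by `a`, `b`, `c`. -/
def valuation (a b c : A) : ℕ → A
  | 0 => a
  | 1 => b
  | _ => c

theorem sat_dnegAx : M.Sat dnegAx ↔ ∀ a, M.neg (M.neg a) = a :=
  ⟨fun h a => h (valuation a a a), fun h _ => h _⟩

theorem sat_deMorganAx :
    M.Sat deMorganAx ↔ ∀ a b, M.neg (M.and a b) = M.or (M.neg a) (M.neg b) :=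
  ⟨fun h a b => h (valuation a b b), fun h _ => h _ _⟩

theorem sat_assocAx : M.Sat assocAx ↔ ∀ a b c, M.and (M.and a b) c = M.and a (M.and b c) :=
  ⟨fun h a b c => h (valuation a b c), fun h _ => h _ _ _⟩

theorem sat_distribAx :
    M.Sat distribAx ↔ ∀ a b c, M.and a (M.or b c) = M.or (M.and a b) (M.and a c) :=
  ⟨fun h a b c => h (valuation a b c), fun h _ => h _ _ _⟩

theorem sat_condAx : M.Sat condAx ↔
    ∀ a b c, M.and (M.or a b) c = M.or (M.and a c) (M.and (M.neg a) (M.and b c)) :=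
  ⟨fun h a b c => h (valuation a b c), fun h _ => h _ _ _⟩

theorem sat_dualAbsAx : M.Sat dualAbsAx ↔ ∀ a b, M.or a (M.and a b) = a :=
  ⟨fun h a b => h (valuation a b b), fun h _ => h _ _⟩

theorem sat_comAx :
    M.Sat comAx ↔ ∀ a b, M.or (M.and a b) (M.and b a) = M.or (M.and b a) (M.and a b) :=
  ⟨fun h a b => h (valuation a b b), fun h _ => h _ _⟩

theorem sat_orAx : M.Sat orAx ↔ ∀ a b, M.or a b = M.neg (M.and (M.neg a) (M.neg b)) :=
  ⟨fun h a b => h (valuation a b b), fun h _ => h _ _⟩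

theorem sat_absAx : M.Sat absAx ↔ ∀ a b, M.and a (M.or a b) = a :=
  ⟨fun h a b => h (valuation a b b), fun h _ => h _ _⟩

theorem sat_memAx : M.Sat memAx ↔
    ∀ a b c, M.and (M.or a b) c = M.or (M.and (M.neg a) (M.and b c)) (M.and a c) :=
  ⟨fun h a b c => h (valuation a b c), fun h _ => h _ _ _⟩

theorem sat_undAx {hU : TV.U ∈ S} :
    M.Sat (undAx hU) ↔ M.neg (M.const ⟨TV.U, hU⟩) = M.const ⟨TV.U, hU⟩ :=
  ⟨fun h => h fun _ => M.const ⟨TV.U, hU⟩, fun h _ => h⟩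

theorem sat_tandAx {hT : TV.T ∈ S} :
    M.Sat (tandAx hT) ↔ ∀ a, M.and (M.const ⟨TV.T, hT⟩) a = a :=
  ⟨fun h a => h (valuation a a a), fun h _ => h _⟩

theorem sat_negTAx {hT : TV.T ∈ S} {hF : TV.F ∈ S} :
    M.Sat (negTAx hT hF) ↔ M.neg (M.const ⟨TV.T, hT⟩) = M.const ⟨TV.F, hF⟩ :=
  ⟨fun h => h fun _ => M.const ⟨TV.T, hT⟩, fun h _ => h⟩

theorem sat_negAx {hT : TV.T ∈ S} {hF : TV.F ∈ S} :
    M.Sat (negAx hT hF) ↔ M.const ⟨TV.F, hF⟩ = M.neg (M.const ⟨TV.T, hT⟩) :=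
  ⟨fun h => h fun _ => M.const ⟨TV.T, hT⟩, fun h _ => h⟩

theorem isModel_iff_sat_gsAxioms (hS : TV.T ∈ S → TV.F ∈ S) :
    M.IsModel ↔ ∀ q ∈ gsAxioms S, M.Sat q := by
  constructor
  · rintro ⟨h, true_and, neg_true, neg_undef⟩ q
      (((rfl | rfl | rfl | rfl | rfl | rfl | rfl) | ⟨hU, rfl⟩) | ⟨hT, hF, rfl | rfl⟩)
    exacts [sat_dnegAx.2 h.neg_neg, sat_deMorganAx.2 h.neg_and, sat_assocAx.2 h.and_assoc,
      sat_distribAx.2 h.and_or_distrib, sat_condAx.2 h.or_and, sat_dualAbsAx.2 h.absorb,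
      sat_comAx.2 h.com, sat_undAx.2 (neg_undef hU), sat_tandAx.2 (true_and hT),
      sat_negTAx.2 (neg_true hT hF)]
  · intro h
    exact
      { isConditional :=
          { neg_neg := sat_dnegAx.1 (h _ (by simp [gsAxioms]))
            neg_and := sat_deMorganAx.1 (h _ (by simp [gsAxioms]))
            and_assoc := sat_assocAx.1 (h _ (by simp [gsAxioms]))
            and_or_distrib := sat_distribAx.1 (h _ (by simp [gsAxioms]))
            or_and := sat_condAx.1 (h _ (by simp [gsAxioms]))
            absorb := sat_dualAbsAx.1 (h _ (by simp [gsAxioms]))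
            com := sat_comAx.1 (h _ (by simp [gsAxioms])) }
        true_and hT := sat_tandAx.1 (h _ (.inr ⟨hT, hS hT, .inl rfl⟩))
        neg_true hT hF := sat_negTAx.1 (h _ (.inr ⟨hT, hF, .inr rfl⟩))
        neg_undef hU := sat_undAx.1 (h _ (.inl (.inr ⟨hU, rfl⟩))) }

end Alg

/-- The axioms Or, Abs, Mem and Com, together with Und if `U` is distinguished, with Neg and Tand if
`T` and `F` are, and with `¬¬x = x` if `T` is not: the common form of the four axiom systems. -/
def sequentialAxioms (S : Set TV) : Set (Equation S) :=
  {orAx, absAx, memAx, comAx}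
    ∪ {e | TV.T ∉ S ∧ e = dnegAx}
    ∪ {e | ∃ hU : TV.U ∈ S, e = undAx hU}
    ∪ {e | ∃ (hT : TV.T ∈ S) (hF : TV.F ∈ S), e = negAx hT hF}
    ∪ {e | ∃ hT : TV.T ∈ S, e = tandAx hT}

theorem eqCLNone_eq_sequentialAxioms : eqCLNone = sequentialAxioms ∅ := by
  simp [eqCLNone, sequentialAxioms]

theorem eqCL_eq_sequentialAxioms : eqCL = sequentialAxioms {TV.T, TV.F} := by
  ext e
  simp only [eqCL, sequentialAxioms, Set.mem_insert_iff, Set.mem_singleton_iff, reduceCtorEq,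
    or_self, or_false, or_true, not_true_eq_false, false_and, IsEmpty.exists_iff,
    exists_true_left, Set.ofPred_false, Set.ofPred_eq_eq_singleton, Set.union_empty,
    Set.union_singleton]
  tauto

theorem eqCLOnlyU_eq_sequentialAxioms : eqCLOnlyU = sequentialAxioms {TV.U} := by
  simp [eqCLOnlyU, sequentialAxioms, Set.insert_comm]

theorem eqCLU_eq_sequentialAxioms : eqCLU = sequentialAxioms {TV.T, TV.F, TV.U} := by
  ext e
  simp only [eqCLU, sequentialAxioms, Set.mem_insert_iff, Set.mem_singleton_iff, reduceCtorEq,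
    or_self, or_false, or_true, not_true_eq_false, false_and, exists_true_left,
    Set.ofPred_false, Set.ofPred_eq_eq_singleton, Set.union_empty, Set.union_singleton]
  tauto

section Completeness

variable {S : Set TV}

theorem Alg.isModel_iff_sat_sequentialAxioms {A : Type*} {M : Alg S A} :
    M.IsModel ↔ ∀ q ∈ sequentialAxioms S, M.Sat q := by
  constructor
  · rintro ⟨hM, true_and, neg_true, neg_undef⟩ q
      (((((rfl | rfl | rfl | rfl) | ⟨-, rfl⟩) | ⟨hU, rfl⟩) | ⟨hT, hF, rfl⟩) | ⟨hT, rfl⟩)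
    all_goals have h := hM.isMemorising
    exacts [sat_orAx.2 h.or_eq, sat_absAx.2 h.absorb, sat_memAx.2 h.mem, sat_comAx.2 h.com,
      sat_dnegAx.2 h.neg_neg, sat_undAx.2 (neg_undef hU), sat_negAx.2 (neg_true hT hF).symm,
      sat_tandAx.2 (true_and hT)]
  · intro h
    have or_eq := sat_orAx.1 (h _ (by simp [sequentialAxioms]))
    have absorb := sat_absAx.1 (h _ (by simp [sequentialAxioms]))
    have mem := sat_memAx.1 (h _ (by simp [sequentialAxioms]))
    have com := sat_comAx.1 (h _ (by simp [sequentialAxioms]))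
    have true_and (hT : TV.T ∈ S) := sat_tandAx.1 (h _ (.inr ⟨hT, rfl⟩))
    have neg_neg : ∀ a, M.neg (M.neg a) = a := by
      by_cases hT : TV.T ∈ S
      · exact neg_neg_of_one_and or_eq absorb mem (true_and hT)
      · exact sat_dnegAx.1 (h _ (.inl (.inl (.inl (.inr ⟨hT, rfl⟩)))))
    exact
      { isConditional := IsMemorising.isConditional ⟨neg_neg, or_eq, absorb, mem, com⟩
        true_and := true_and
        neg_true hT hF := (sat_negAx.1 (h _ (.inl (.inr ⟨hT, hF, rfl⟩)))).symm
        neg_undef hU := sat_undAx.1 (h _ (.inl (.inl (.inr ⟨hU, rfl⟩)))) }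

theorem completelyAxiomatisesCL_sequentialAxioms (hS : TV.T ∈ S ↔ TV.F ∈ S) :
    CompletelyAxiomatisesCL.{u} (sequentialAxioms S) := by
  intro X s t
  have iff_valid : Derivable (sequentialAxioms S) s t ↔ Valid s t :=
    Derivable.iff_valid hS.2 (Alg.isModel_iff_sat_sequentialAxioms.1 (isModel_standard S))
      (Alg.isModel_iff_sat_sequentialAxioms.2 fun _ => Derivable.sat_freeAlg)
  have gs_iff_valid : Derivable (gsAxioms S) s t ↔ Valid s t :=
    Derivable.iff_valid hS.2
      ((Alg.isModel_iff_sat_gsAxioms hS.1).1 (isModel_standard S))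
      ((Alg.isModel_iff_sat_gsAxioms hS.1).2 fun _ => Derivable.sat_freeAlg)
  exact ⟨iff_valid, iff_valid.trans gs_iff_valid.symm⟩

end Completeness

/-! ### Independence -/

section Independence

variable (S : Set TV)

/-- An algebra that satisfies all axioms but Or. -/
def orModel : Alg S (Fin 3) where
  neg := Fin.rev
  and a b := if b = 1 then a else b
  or a b := if a = b then a else 1
  const _ := 1

/-- An algebra that satisfies all axioms but Abs. -/
def absModel : Alg S Bool where
  neg := id
  and := or
  or := or
  const _ := false

/-- Kleene's strong three-valued logic, with `0 = F`, `1 = U` and `2 = T`; it satisfies all axioms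
but Mem. -/
def memModel : Alg S (Fin 3) where
  neg := Fin.rev
  and := min
  or := max
  const c :=
    match c.1 with
    | TV.T => 2
    | TV.F => 0
    | TV.U => 1

/-- Short-circuit logic with two undefined truth values `2` and `3` besides `0 = F` and `1 = T`; it
satisfies all axioms but Com. -/
def comModel : Alg S (Fin 4) where
  neg := Equiv.swap 0 1
  and a b := if a = 1 then b else a
  or a b := if a = 0 then b else a
  const c :=
    match c.1 with
    | TV.T => 1
    | TV.F => 0
    | TV.U => 2

/-- An algebra that satisfies all axioms but `¬¬x = x` and Tand. -/
def dnegModel : Alg S Bool where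
  neg _ := false
  and a _ := a
  or _ _ := false
  const _ := false

/-- The algebra `C`, except that the constant `c` denotes `k c`. -/
def renamedStandard (k : TV → TV) : Alg S TV where
  neg := TV.neg
  and := TV.and
  or := TV.or
  const c := k c

variable {S} {r : Equation S}

theorem sat_orModel (hr : r ∈ sequentialAxioms S) (hor : r ≠ orAx) : (orModel S).Sat r := by
  rcases hr with
    ((((rfl | rfl | rfl | rfl) | ⟨-, rfl⟩) | ⟨hU, rfl⟩) | ⟨hT, hF, rfl⟩) | ⟨hT, rfl⟩
  · contradiction
  · simp only [Alg.sat_absAx, orModel]; decide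
  · simp only [Alg.sat_memAx, orModel]; decide
  · simp only [Alg.sat_comAx, orModel]; decide
  · simp only [Alg.sat_dnegAx, orModel]; decide
  · simp only [Alg.sat_undAx, orModel]; decide
  · simp only [Alg.sat_negAx, orModel]; decide
  · simp only [Alg.sat_tandAx, orModel]; decide

theorem sat_absModel (hr : r ∈ sequentialAxioms S) (habs : r ≠ absAx) : (absModel S).Sat r := by
  rcases hr with
    ((((rfl | rfl | rfl | rfl) | ⟨-, rfl⟩) | ⟨hU, rfl⟩) | ⟨hT, hF, rfl⟩) | ⟨hT, rfl⟩
  · simp only [Alg.sat_orAx, absModel]; decide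
  · contradiction
  · simp only [Alg.sat_memAx, absModel]; decide
  · simp only [Alg.sat_comAx, absModel]; decide
  · simp only [Alg.sat_dnegAx, absModel]; decide
  · simp only [Alg.sat_undAx, absModel]; decide
  · simp only [Alg.sat_negAx, absModel]; decide
  · simp only [Alg.sat_tandAx, absModel]; decide

theorem sat_memModel (hr : r ∈ sequentialAxioms S) (hmem : r ≠ memAx) : (memModel S).Sat r := by
  rcases hr with
    ((((rfl | rfl | rfl | rfl) | ⟨-, rfl⟩) | ⟨hU, rfl⟩) | ⟨hT, hF, rfl⟩) | ⟨hT, rfl⟩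
  · simp only [Alg.sat_orAx, memModel]; decide
  · simp only [Alg.sat_absAx, memModel]; decide
  · contradiction
  · simp only [Alg.sat_comAx, memModel]; decide
  · simp only [Alg.sat_dnegAx, memModel]; decide
  · simp only [Alg.sat_undAx, memModel]; decide
  · simp only [Alg.sat_negAx, memModel]; decide
  · simp only [Alg.sat_tandAx, memModel]; decide

theorem sat_comModel (hr : r ∈ sequentialAxioms S) (hcom : r ≠ comAx) : (comModel S).Sat r := by
  rcases hr with
    ((((rfl | rfl | rfl | rfl) | ⟨-, rfl⟩) | ⟨hU, rfl⟩) | ⟨hT, hF, rfl⟩) | ⟨hT, rfl⟩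
  · simp only [Alg.sat_orAx, comModel]; decide
  · simp only [Alg.sat_absAx, comModel]; decide
  · simp only [Alg.sat_memAx, comModel]; decide
  · contradiction
  · simp only [Alg.sat_dnegAx, comModel]; decide
  · simp only [Alg.sat_undAx, comModel]; decide
  · simp only [Alg.sat_negAx, comModel]; decide
  · simp only [Alg.sat_tandAx, comModel]; decide

theorem sat_dnegModel (hT : TV.T ∉ S) (hr : r ∈ sequentialAxioms S) (hdneg : r ≠ dnegAx) :
    (dnegModel S).Sat r := by
  rcases hr with
    ((((rfl | rfl | rfl | rfl) | ⟨-, rfl⟩) | ⟨hU, rfl⟩) | ⟨hT', -⟩) | ⟨hT', -⟩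
  · simp only [Alg.sat_orAx, dnegModel]; decide
  · simp only [Alg.sat_absAx, dnegModel]; decide
  · simp only [Alg.sat_memAx, dnegModel]; decide
  · simp only [Alg.sat_comAx, dnegModel]; decide
  · contradiction
  · simp only [Alg.sat_undAx, dnegModel]
  · contradiction
  · contradiction

theorem sat_renamedStandard {k : TV → TV} {q : Equation S}
    (und : ∀ hU, undAx hU ≠ q → (k TV.U).neg = k TV.U)
    (neg : ∀ hT hF, negAx hT hF ≠ q → k TV.F = (k TV.T).neg)
    (tand : ∀ hT, tandAx hT ≠ q → ∀ a, (k TV.T).and a = a)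
    (hr : r ∈ sequentialAxioms S) (hq : r ≠ q) : (renamedStandard S k).Sat r := by
  have h := isMemorising_standard
  rcases hr with
    ((((rfl | rfl | rfl | rfl) | ⟨-, rfl⟩) | ⟨hU, rfl⟩) | ⟨hT, hF, rfl⟩) | ⟨hT, rfl⟩
  exacts [Alg.sat_orAx.2 h.or_eq, Alg.sat_absAx.2 h.absorb, Alg.sat_memAx.2 h.mem,
    Alg.sat_comAx.2 h.com, Alg.sat_dnegAx.2 h.neg_neg, Alg.sat_undAx.2 (und hU hq),
    Alg.sat_negAx.2 (neg hT hF hq), Alg.sat_tandAx.2 (tand hT hq)]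

theorem independent_sequentialAxioms (S : Set TV) : Independent (sequentialAxioms S) := by
  rintro q (((((rfl | rfl | rfl | rfl) | ⟨hT, rfl⟩) | ⟨hU, rfl⟩) | ⟨hT, hF, rfl⟩) | ⟨hT, rfl⟩)
  · exact Derivable.not_of_sat (fun _ => sat_orModel)
      (by simp only [Alg.sat_orAx, orModel]; decide)
  · exact Derivable.not_of_sat (fun _ => sat_absModel)
      (by simp only [Alg.sat_absAx, absModel]; decide)
  · exact Derivable.not_of_sat (fun _ => sat_memModel)
      (by simp only [Alg.sat_memAx, memModel]; decide)
  · exact Derivable.not_of_sat (fun _ => sat_comModel)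
      (by simp only [Alg.sat_comAx, comModel]; decide)
  · exact Derivable.not_of_sat (fun _ => sat_dnegModel hT)
      (by simp only [Alg.sat_dnegAx, dnegModel]; decide)
  · refine Derivable.not_of_sat (M := renamedStandard S (Function.update id TV.U TV.T))
      (fun _ => sat_renamedStandard ?_ ?_ ?_) ?_
    · exact fun _ h => absurd rfl h
    · exact fun _ _ _ => rfl
    · exact fun _ _ _ => rfl
    · simp only [Alg.sat_undAx, renamedStandard]; decide
  · refine Derivable.not_of_sat (M := renamedStandard S (Function.update id TV.F TV.T))
      (fun _ => sat_renamedStandard ?_ ?_ ?_) ?_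
    · exact fun _ _ => rfl
    · exact fun _ _ h => absurd rfl h
    · exact fun _ _ _ => rfl
    · simp only [Alg.sat_negAx, renamedStandard]; decide
  · refine Derivable.not_of_sat (M := renamedStandard S fun _ => TV.U)
      (fun _ => sat_renamedStandard ?_ ?_ ?_) ?_
    · exact fun _ _ => rfl
    · exact fun _ _ _ => rfl
    · exact fun _ h => absurd rfl h
    · simp only [Alg.sat_tandAx, renamedStandard]; decide

end Independence

end CondLogic

theorem mainTheorem8 :
    (CondLogic.CompletelyAxiomatisesCL.{u} CondLogic.eqCLNone ∧
      CondLogic.Independent CondLogic.eqCLNone) ∧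
    (CondLogic.CompletelyAxiomatisesCL.{u} CondLogic.eqCL ∧
      CondLogic.Independent CondLogic.eqCL) ∧
    (CondLogic.CompletelyAxiomatisesCL.{u} CondLogic.eqCLOnlyU ∧
      CondLogic.Independent CondLogic.eqCLOnlyU) ∧
    (CondLogic.CompletelyAxiomatisesCL.{u} CondLogic.eqCLU ∧
      CondLogic.Independent CondLogic.eqCLU) := by
  have complete_and_independent (S : Set CondLogic.TV) (hS : CondLogic.TV.T ∈ S ↔ .F ∈ S) :
      CondLogic.CompletelyAxiomatisesCL.{u} (CondLogic.sequentialAxioms S) ∧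
        CondLogic.Independent (CondLogic.sequentialAxioms S) :=
    ⟨CondLogic.completelyAxiomatisesCL_sequentialAxioms hS,
      CondLogic.independent_sequentialAxioms S⟩
  rw [CondLogic.eqCLNone_eq_sequentialAxioms, CondLogic.eqCL_eq_sequentialAxioms,
    CondLogic.eqCLOnlyU_eq_sequentialAxioms, CondLogic.eqCLU_eq_sequentialAxioms]
  exact ⟨complete_and_independent _ (by simp), complete_and_independent _ (by simp),
    complete_and_independent _ (by simp), complete_and_independent _ (by simp)⟩
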